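/- Let $n\ge 3$ and let $G$ be a group. Let $G\wr S_n=G^n\rtimes S_n$, where $S_n$ acts on $G^n$ on the right by permuting the factors: $(g^s)_i=g_{s(i)}$ and $(g,s)(h,t)=(g\cdot h^{(s^{-1})},st)$. For $s\in S_n$ and $g\in G^n$ write $s^g=(g,1)^{-1}(1,s)(g,1)\in G\wr S_n$. Let $S_n(G)$ be the free product of copies $S_n^{(g)}$ of $S_n$ indexed by $g\in G^n$, modulo the relations $s_g=s_h$ whenever $s^g=s^h$ in $G\wr S_n$; here $s_g$ denotes the image of $s\in S_n$ under $S_n^{(g)}\to S_n(G)$. Let $\mu\colon S_n(G)\to G\wr S_n$ be the homomorphism $s_g\mapsto s^g$, let $\pi\colon S_n(G)\to S_n$ be the homomorphism $s_g\mapsto s$, and put $HS_n(G)=\operatorname{Ker}(\pi)$. For $i\ne j$ and $a\in G$ put $(ij)_a=(ij)_{a[j]}\in S_n(G)$, where $a[j]\in G^n$ has $a$ in position $j$ and $1$ elsewhere, and $h_{ij}(a)=(ij)_a(ij)_1\in HS_n(G)$. Let $D_n(G)\le G^n$ be the subgroup of all $(g_1,\dots,g_n)$ with $g_1g_2\cdots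 g_n\in[G,G]$, and let $d_{ij}(u)\in D_n(G)$ have $i$-th component $u$, $j$-th component $u^{-1}$, and all other components trivial. The map $\mu$ restricts to a homomorphism $HS_n(G)\to D_n(G)$. Let $H_n(G)$ be Rehmann's group, with generators $h_{ij}(u)$ ($1\le i\neq j\le n$, $u\in G$) and relations (distinct letters denote distinct indices) \begin{align*} h_{ij}(u)h_{ji}(u)&=1, & h_{ij}(u)h_{ki}(u)h_{jk}(u)&=1,\\ h_{ij}(u)h_{ik}(v)h_{ij}(u)^{-1}&=h_{ik}(uv)h_{ik}(u)^{-1}, & h_{ij}(u)h_{kj}(v)h_{ij}(u)^{-1}&=h_{kj}(vu)h_{kj}(u)^{-1},\\ [h_{ij}(u),h_{kl}(v)]&=1, \end{align*} together with the homomorphism $H_n(G)\to D_n(G)$, $h_{ij}(u)\mapsto d_{ij}(u)$. An extension of type $\mathfrak H_n(G)$ is a surjective homomorphism $p\colon H\to D_n(G)$ for which there is a surjective homomorphism $q\colon H_n(G)\to H$ such that $p\circ q$ is the homomorphism $H_n(G)\to D_n(G)$ above. Then: (1) $h_{ij}(a)\mapsto h_{ij}(a)$ defines an isomorphism from the quotient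 of $H_n(G)$ by the relations $h_{ij}(a)^{-1}=h_{ij}(a^{-1})$ ($i\ne j$, $a\in G$) onto $HS_n(G)$. (2) $HS_n(G)\to D_n(G)$ is an extension of type $\mathfrak H_n(G)$. (3) $\operatorname{Ker}(\mu\colon S_n(G)\to G\wr S_n)=\operatorname{Ker}(HS_n(G)\to D_n(G))$ as subgroups of $S_n(G)$, and there is an isomorphism, natural in $G$, of this group with $H_2(G,\mathbb Z)$, where a homomorphism $f\colon G\to G'$ induces $S_n(G)\to S_n(G')$, $s_g\mapsto s_{f(g)}$. -/

import Mathlib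

universe u

namespace ParamSym

open Equiv

/-- The wreath product `G ≀ S_n = G^n ⋊ S_n`, with multiplication
`(g, s) (h, t) = (g * (h ∘ s⁻¹), s t)`. The right action of `S_n` on `G^n` is `g ^ s = g ∘ s`. -/
abbrev Wreath (n : ℕ) (G : Type u) [Group G] : Type u :=
  SemidirectProduct (Fin n → G) (Perm (Fin n)) mulAutArrow

/-- The conjugate `s ^ g = (g, 1)⁻¹ (1, s) (g, 1)` in the wreath product. -/
def conjPerm (n : ℕ) (G : Type u) [Group G] (s : Perm (Fin n)) (g : Fin n → G) : Wreath n G :=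
  (SemidirectProduct.inl g)⁻¹ * SemidirectProduct.inr s * SemidirectProduct.inl g

/-- The free product of copies of `S_n` indexed by `G^n`. -/
abbrev FreeProd (n : ℕ) (G : Type u) : Type u :=
  Monoid.CoprodI (fun _ : Fin n → G => Perm (Fin n))

/-- The element `s_g` of the free product. -/
def freeSym (n : ℕ) (G : Type u) (s : Perm (Fin n)) (g : Fin n → G) : FreeProd n G :=
  Monoid.CoprodI.of (M := fun _ : Fin n → G => Perm (Fin n)) (i := g) s

/-- The relators `s_g * s_h⁻¹`, one for each equality `s ^ g = s ^ h` in `G ≀ S_n`. -/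
def symRels (n : ℕ) (G : Type u) [Group G] : Set (FreeProd n G) :=
  {x | ∃ (s : Perm (Fin n)) (g h : Fin n → G),
    conjPerm n G s g = conjPerm n G s h ∧ x = freeSym n G s g * (freeSym n G s h)⁻¹}

/-- The parametrized symmetric group `S_n(G)`: the free product of copies of `S_n` indexed by
`G^n`, modulo `s_g = s_h` whenever `s ^ g = s ^ h` in `G ≀ S_n`. -/
abbrev SymG (n : ℕ) (G : Type u) [Group G] : Type u :=
  FreeProd n G ⧸ Subgroup.normalClosure (symRels n G)

/-- The element `s_g` of `S_n(G)`. -/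
def sym (n : ℕ) (G : Type u) [Group G] (s : Perm (Fin n)) (g : Fin n → G) : SymG n G :=
  QuotientGroup.mk (freeSym n G s g)

/-- Homomorphisms out of `S_n(G)`, from a family of homomorphisms on the copies of `S_n`. -/
def symLift (n : ℕ) (G : Type u) [Group G] {K : Type*} [Group K]
    (φ : (Fin n → G) → Perm (Fin n) →* K)
    (hφ : ∀ s g h, conjPerm n G s g = conjPerm n G s h → φ g s = φ h s) : SymG n G →* K :=
  QuotientGroup.lift _ (Monoid.CoprodI.lift φ) (by
    have : Subgroup.normalClosure (symRels n G) ≤ (Monoid.CoprodI.lift φ).ker := by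
      apply Subgroup.normalClosure_le_normal
      rintro x ⟨s, g, h, hgh, rfl⟩
      simp [MonoidHom.mem_ker, freeSym, hφ s g h hgh]
    exact fun x hx => this hx)

theorem symLift_sym (n : ℕ) (G : Type u) [Group G] {K : Type*} [Group K]
    (φ : (Fin n → G) → Perm (Fin n) →* K)
    (hφ : ∀ s g h, conjPerm n G s g = conjPerm n G s h → φ g s = φ h s)
    (s : Perm (Fin n)) (g : Fin n → G) : symLift n G φ hφ (sym n G s g) = φ g s := by
  simp [symLift, sym, freeSym]

theorem sym_hom_ext (n : ℕ) (G : Type u) [Group G] {K : Type*} [Group K] {α β : SymG n G →* K}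
    (h : ∀ s g, α (sym n G s g) = β (sym n G s g)) : α = β := by
  apply QuotientGroup.monoidHom_ext
  apply Monoid.CoprodI.ext_hom
  intro g
  ext s
  exact h s g

/-- The homomorphism `s ↦ s ^ g` from `S_n` to `G ≀ S_n`. -/
def conjHom (n : ℕ) (G : Type u) [Group G] (g : Fin n → G) : Perm (Fin n) →* Wreath n G where
  toFun s := conjPerm n G s g
  map_one' := by simp [conjPerm]
  map_mul' s t := by simp [conjPerm, mul_assoc]

/-- The homomorphism `μ : S_n(G) → G ≀ S_n`, `s_g ↦ s ^ g`. -/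
def mu (n : ℕ) (G : Type u) [Group G] : SymG n G →* Wreath n G :=
  symLift n G (conjHom n G) (fun _ _ _ h => h)

theorem mu_sym (n : ℕ) (G : Type u) [Group G] (s : Perm (Fin n)) (g : Fin n → G) :
    mu n G (sym n G s g) = conjPerm n G s g := symLift_sym ..

/-- The homomorphism `π : S_n(G) → S_n`, `s_g ↦ s`. -/
def projPerm (n : ℕ) (G : Type u) [Group G] : SymG n G →* Perm (Fin n) :=
  SemidirectProduct.rightHom.comp (mu n G)

/-- `HS_n(G)`, the kernel of `S_n(G) → S_n`. -/
def HS (n : ℕ) (G : Type u) [Group G] : Subgroup (SymG n G) := (projPerm n G).ker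

/-- The element `(i j)_a` of `S_n(G)`: the transposition `(i j)` in the copy of `S_n` indexed by
the vector whose only nontrivial component is `a`, in position `j`. -/
def transp (n : ℕ) (G : Type u) [Group G] (i j : Fin n) (a : G) : SymG n G :=
  sym n G (swap i j) (Pi.mulSingle j a)

/-- The element `h_ij(a) = (i j)_a (i j)_1` of `S_n(G)`; it lies in `HS_n(G)`. -/
def hS (n : ℕ) (G : Type u) [Group G] (i j : Fin n) (a : G) : SymG n G :=
  transp n G i j a * transp n G i j 1

/-- The product of the components of a vector, read in the abelianization. -/
def abProd (n : ℕ) (G : Type u) [Group G] : (Fin n → G) →* Abelianization G where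
  toFun g := ∏ i, Abelianization.of (g i)
  map_one' := by simp
  map_mul' g h := by simp [Finset.prod_mul_distrib]

theorem prod_mem_commutator_iff (n : ℕ) (G : Type u) [Group G] (g : Fin n → G) :
    (List.ofFn g).prod ∈ commutator G ↔ abProd n G g = 1 := by
  rw [← Abelianization.ker_of, MonoidHom.mem_ker, map_list_prod, List.map_ofFn, List.prod_ofFn]
  rfl

/-- The subgroup `D_n(G)` of `G^n` of all vectors with `g_1 g_2 ⋯ g_n ∈ [G, G]`. -/
def D (n : ℕ) (G : Type u) [Group G] : Subgroup (Fin n → G) where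
  carrier := {g | (List.ofFn g).prod ∈ commutator G}
  one_mem' := by
    simp only [Set.mem_ofPred_eq, prod_mem_commutator_iff, map_one]
  mul_mem' {a b} ha hb := by
    simp only [Set.mem_ofPred_eq, prod_mem_commutator_iff, map_mul] at *
    simp [ha, hb]
  inv_mem' {a} ha := by
    simp only [Set.mem_ofPred_eq, prod_mem_commutator_iff, map_inv] at *
    simp [ha]

theorem mem_D_iff (n : ℕ) (G : Type u) [Group G] (g : Fin n → G) :
    g ∈ D n G ↔ abProd n G g = 1 := prod_mem_commutator_iff n G g

/-- The vector `d_ij(u)` with `u` in position `i`, `u⁻¹` in position `j`, and `1` elsewhere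
(for `i ≠ j`). -/
def dVec (n : ℕ) (G : Type u) [Group G] (i j : Fin n) (u : G) : Fin n → G :=
  Pi.mulSingle i u * Pi.mulSingle j u⁻¹

theorem abProd_mulSingle (n : ℕ) (G : Type u) [Group G] (i : Fin n) (u : G) :
    abProd n G (Pi.mulSingle i u) = Abelianization.of u := by
  have : ∀ k, Abelianization.of ((Pi.mulSingle i u : Fin n → G) k)
      = if k = i then Abelianization.of u else 1 := by
    intro k
    by_cases h : k = i
    · subst h; simp
    · simp [h]
  simp [abProd, this]

theorem dVec_mem (n : ℕ) (G : Type u) [Group G] (i j : Fin n) (u : G) :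
    dVec n G i j u ∈ D n G := by
  simp [mem_D_iff, dVec, abProd_mulSingle]

/-- The generators `h_ij(u)`, `i ≠ j`, `u ∈ G`. -/
abbrev HGen (n : ℕ) (G : Type u) : Type u := {p : Fin n × Fin n // p.1 ≠ p.2} × G

/-- The generator `h_ij(u)` in the free group. -/
def fh {n : ℕ} {G : Type u} (i j : Fin n) (hij : i ≠ j) (u : G) : FreeGroup (HGen n G) :=
  FreeGroup.of (⟨(i, j), hij⟩, u)

open scoped commutatorElement in
/-- The defining relators of Rehmann's group `H_n(G)`; distinct letters are distinct indices. -/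
inductive HRel (n : ℕ) (G : Type u) [Group G] : FreeGroup (HGen n G) → Prop
  | rel1 (i j : Fin n) (hij : i ≠ j) (u : G) :
      HRel n G (fh i j hij u * fh j i hij.symm u)
  | rel2 (i j k : Fin n) (hij : i ≠ j) (hki : k ≠ i) (hjk : j ≠ k) (u : G) :
      HRel n G (fh i j hij u * fh k i hki u * fh j k hjk u)
  | rel3 (i j k : Fin n) (hij : i ≠ j) (hik : i ≠ k) (hjk : j ≠ k) (u v : G) :
      HRel n G (fh i j hij u * fh i k hik v * (fh i j hij u)⁻¹ *
        (fh i k hik (u * v) * (fh i k hik u)⁻¹)⁻¹)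
  | rel4 (i j k : Fin n) (hij : i ≠ j) (hkj : k ≠ j) (hik : i ≠ k) (u v : G) :
      HRel n G (fh i j hij u * fh k j hkj v * (fh i j hij u)⁻¹ *
        (fh k j hkj (v * u) * (fh k j hkj u)⁻¹)⁻¹)
  | rel5 (i j k l : Fin n) (hij : i ≠ j) (hkl : k ≠ l) (hik : i ≠ k) (hil : i ≠ l)
      (hjk : j ≠ k) (hjl : j ≠ l) (u v : G) :
      HRel n G ⁅fh i j hij u, fh k l hkl v⁆

/-- Rehmann's group `H_n(G)`. -/
abbrev RehmannH (n : ℕ) (G : Type u) [Group G] : Type u := PresentedGroup {r | HRel n G r}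

/-- The generator `h_ij(u)` of `H_n(G)`. -/
def hGen {n : ℕ} {G : Type u} [Group G] (i j : Fin n) (hij : i ≠ j) (u : G) : RehmannH n G :=
  PresentedGroup.of (⟨(i, j), hij⟩, u)

/-- The homomorphism `H_n(G) → D_n(G)`, `h_ij(u) ↦ d_ij(u)`. -/
def HtoD (n : ℕ) (G : Type u) [Group G] : RehmannH n G →* D n G :=
  PresentedGroup.toGroup
    (f := fun x : HGen n G => (⟨dVec n G x.1.1.1 x.1.1.2 x.2, dVec_mem n G _ _ _⟩ : D n G)) (by
    intro r hr
    apply Subtype.ext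
    funext m
    simp only [Set.mem_ofPred_eq] at hr
    induction hr with
    | rel1 i j hij u =>
      simp only [fh, map_mul, FreeGroup.lift_apply_of, dVec, Subgroup.coe_mul, Pi.mul_apply,
        Subgroup.coe_one, Pi.one_apply, Pi.mulSingle_apply]
      split_ifs <;> simp_all
    | rel2 i j k hij hki hjk u =>
      simp only [fh, map_mul, FreeGroup.lift_apply_of, dVec, Subgroup.coe_mul, Pi.mul_apply,
        Subgroup.coe_one, Pi.one_apply, Pi.mulSingle_apply]
      split_ifs <;> simp_all
    | rel3 i j k hij hik hjk u v =>
      simp only [fh, map_mul, map_inv, FreeGroup.lift_apply_of, dVec, Subgroup.coe_mul,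
        Subgroup.coe_inv, Pi.mul_apply, Pi.inv_apply, Subgroup.coe_one, Pi.one_apply,
        Pi.mulSingle_apply]
      split_ifs <;> simp_all
    | rel4 i j k hij hkj hik u v =>
      simp only [fh, map_mul, map_inv, FreeGroup.lift_apply_of, dVec, Subgroup.coe_mul,
        Subgroup.coe_inv, Pi.mul_apply, Pi.inv_apply, Subgroup.coe_one, Pi.one_apply,
        Pi.mulSingle_apply]
      split_ifs <;> simp_all [mul_assoc]
    | rel5 i j k l hij hkl hik hil hjk hjl u v =>
      simp only [fh, commutatorElement_def, map_mul, map_inv, FreeGroup.lift_apply_of, dVec,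
        Subgroup.coe_mul, Subgroup.coe_inv, Pi.mul_apply, Pi.inv_apply, Subgroup.coe_one,
        Pi.one_apply, Pi.mulSingle_apply]
      split_ifs <;> simp_all)

/-- The normal subgroup of `H_n(G)` generated by the relation `h_ij(a)⁻¹ = h_ij(a⁻¹)`. -/
def invRel (n : ℕ) (G : Type u) [Group G] : Subgroup (RehmannH n G) :=
  Subgroup.normalClosure
    {x | ∃ (i j : Fin n) (hij : i ≠ j) (a : G), x = (hGen i j hij a)⁻¹ * (hGen i j hij a⁻¹)⁻¹}

instance (n : ℕ) (G : Type u) [Group G] : (invRel n G).Normal :=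
  Subgroup.normalClosure_normal

/-- `p : K → D_n(G)` is an extension of type `𝔥_n(G)`: the homomorphism `p` is surjective and there
is a surjection `H_n(G) → K` through which the canonical map `H_n(G) → D_n(G)` factors. -/
def IsExtensionOfTypeH (n : ℕ) (G : Type u) [Group G] {K : Type u} [Group K]
    (p : K →* D n G) : Prop :=
  Function.Surjective p ∧
    ∃ q : RehmannH n G →* K, Function.Surjective q ∧ p.comp q = HtoD n G

theorem mu_left_mem_D (n : ℕ) (G : Type u) [Group G] (x : SymG n G) :
    (mu n G x).left ∈ D n G := by
  have perm_inv : ∀ (s : Perm (Fin n)) (g : Fin n → G),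
      abProd n G (mulAutArrow s g) = abProd n G g := by
    intro s g
    exact Equiv.prod_comp s⁻¹ (fun i => Abelianization.of (g i))
  let θ : Wreath n G →* Abelianization G :=
    { toFun := fun w => abProd n G w.left
      map_one' := by simp
      map_mul' := fun a b => by simp [perm_inv] }
  have key : θ.comp (mu n G) = 1 := by
    apply sym_hom_ext
    intro s g
    simp [θ, mu_sym, conjPerm, perm_inv]
  rw [mem_D_iff]
  exact DFunLike.congr_fun key x

/-- The restriction of `μ` to a homomorphism `HS_n(G) → D_n(G)`. -/
def HStoD (n : ℕ) (G : Type u) [Group G] : HS n G →* D n G where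
  toFun x := ⟨(mu n G x).left, mu_left_mem_D n G x⟩
  map_one' := by apply Subtype.ext; simp
  map_mul' x y := by
    apply Subtype.ext
    have hx : (mu n G (x : SymG n G)).right = 1 := x.2
    simp [hx]

/-- The map of wreath products induced by a group homomorphism. -/
def wreathMap (n : ℕ) {G G' : Type u} [Group G] [Group G'] (f : G →* G') :
    Wreath n G →* Wreath n G' where
  toFun w := ⟨fun i => f (w.left i), w.right⟩
  map_one' := by ext <;> simp
  map_mul' a b := by
    ext x
    · exact map_mul f _ _
    · simp

theorem wreathMap_conjPerm (n : ℕ) {G G' : Type u} [Group G] [Group G'] (f : G →* G')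
    (s : Perm (Fin n)) (g : Fin n → G) :
    wreathMap n f (conjPerm n G s g) = conjPerm n G' s (fun i => f (g i)) := by
  ext x
  · simp only [wreathMap, conjPerm, MonoidHom.coe_mk, OneHom.coe_mk, SemidirectProduct.mul_left,
      Pi.mul_apply, map_mul]
    simp
  · simp [wreathMap, conjPerm]

/-- The homomorphism `S_n(G) → S_n(G')`, `s_g ↦ s_{f(g)}`, induced by `f : G → G'`. -/
def symMap (n : ℕ) {G G' : Type u} [Group G] [Group G'] (f : G →* G') : SymG n G →* SymG n G' :=
  symLift n G
    (fun g => (QuotientGroup.mk' (Subgroup.normalClosure (symRels n G'))).comp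
      (Monoid.CoprodI.of (M := fun _ : Fin n → G' => Perm (Fin n)) (i := fun i => f (g i))))
    (by
      intro s g k hgk
      have hr := congrArg (wreathMap n f) hgk
      rw [wreathMap_conjPerm, wreathMap_conjPerm] at hr
      change (QuotientGroup.mk (freeSym n G' s fun i => f (g i)) : SymG n G') =
        QuotientGroup.mk (freeSym n G' s fun i => f (k i))
      rw [← mul_inv_eq_one, ← QuotientGroup.mk_inv, ← QuotientGroup.mk_mul,
        QuotientGroup.eq_one_iff]
      exact Subgroup.subset_normalClosure ⟨s, _, _, hr, rfl⟩)

theorem symMap_sym (n : ℕ) {G G' : Type u} [Group G] [Group G'] (f : G →* G')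
    (s : Perm (Fin n)) (g : Fin n → G) :
    symMap n f (sym n G s g) = sym n G' s (fun i => f (g i)) := symLift_sym ..

theorem mu_symMap (n : ℕ) {G G' : Type u} [Group G] [Group G'] (f : G →* G') (x : SymG n G) :
    mu n G' (symMap n f x) = wreathMap n f (mu n G x) := by
  have : (mu n G').comp (symMap n f) = (wreathMap n f).comp (mu n G) := by
    apply sym_hom_ext
    intro s g
    simp [symMap_sym, mu_sym, wreathMap_conjPerm]
  exact DFunLike.congr_fun this x

/-- The homomorphism `Ker(S_n(G) → G ≀ S_n) → Ker(S_n(G') → G' ≀ S_n)` induced by `f : G → G'`. -/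
def kerMuMap (n : ℕ) {G G' : Type u} [Group G] [Group G'] (f : G →* G') :
    (mu n G).ker →* (mu n G').ker :=
  ((symMap n f).comp (mu n G).ker.subtype).codRestrict (mu n G').ker (by
    rintro ⟨x, hx⟩
    rw [MonoidHom.mem_ker] at hx ⊢
    simp [mu_symMap, hx])

/-- The second homology `H_2(G, k)` with trivial coefficients. -/
noncomputable abbrev H2 (k G : Type u) [CommRing k] [Group G] : ModuleCat.{u} k :=
  groupHomology (Rep.trivial k G k) 2

/-- The map `H_2(G, k) → H_2(G', k)` induced by `f : G → G'`. -/
noncomputable def H2map (k : Type u) [CommRing k] {G G' : Type u} [Group G] [Group G']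
    (f : G →* G') : H2 k G →+ H2 k G' :=
  (groupHomology.map (A := Rep.trivial k G k) (B := Rep.trivial k G' k) f
    (CategoryTheory.CategoryStruct.id (Rep.trivial k G k)) 2).hom.toAddMonoidHom

/-- The integral homology group `H_2(G, ℤ)` of a group `G : Type u`, written multiplicatively.
The coefficient ring has to live in the universe of `G`, hence the copy `ULift ℤ` of `ℤ`. -/
abbrev H2Z (G : Type u) [Group G] : Type u := Multiplicative (H2 (ULift.{u} ℤ) G)

/-- The map `H_2(G, ℤ) → H_2(G', ℤ)` induced by `f : G → G'`. -/
noncomputable def H2Zmap {G G' : Type u} [Group G] [Group G'] (f : G →* G') :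
    H2Z G →* H2Z G' :=
  AddMonoidHom.toMultiplicative (H2map (ULift.{u} ℤ) f)

end ParamSym

/-! Replace `G` by its tautological central extension `TautExt G`, whose kernel is the group of
2-chains modulo boundaries and whose defining cocycle is the universal one. Modulo `antiDiag`, the
central vectors of product one, the conjugate of a permutation by a lift of `g` does not depend on
the lift. Hence `s_g ↦ s ^ (sec g)` is a homomorphism `muLift` from `S_n(G)` to `WreathQuot n G`
lying over `μ`. Everything follows from computing its kernel and its image.

The kernel. Transposition calculus in `S_n(G)` gives Rehmann's relations and `h_ij(a)⁻¹ =
h_ij(a⁻¹)`, so `toHS` is defined, and it is onto because the `h_ij(a)` generate `HS_n(G)`. An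
element of the source that dies in `D_n(G)` is a product of defects `gam`, where `gam u v` is at
once the failure of `h_ik` to be anti-multiplicative and the commutator of `h_ij(u)` with `h_ik(v)`
(`mem_gamClosure_of_toHS`). The relations force these defects to satisfy the identities of a
nonabelian exterior square (`PairRel.exists_crossedPairing`). Every such pairing is realized
faithfully by commutators in a central extension of `G` (`liftGroup`), hence in an image of `TautExt
G`, which maps to all central extensions. Since `muLift` sends `gam u v` to the commutator of `sec
u` and `sec v` placed in one coordinate, no nontrivial product of defects can die. So `muLift ∘
toHS` is injective, which gives both the presentation of `HS_n(G)` and the injectivity of `muLift`.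

The image. An element of `Ker μ` goes to a central vector, determined modulo `antiDiag` by one
2-chain modulo boundaries. The invariant `epsW` vanishes on the image of `muLift`, so this chain is
a cycle. Conversely a cycle lies in the commutator subgroup of `TautExt G`, and the image of
`muLift` contains that of `D_n(TautExt G)`. So `Ker μ` is `H_2(G, ℤ)`, and naturality holds because
every construction is functorial in `G`. -/

namespace ParamSym

/-! ### Realizing a crossed pairing by commutators in a central extension -/

/-- A group `L` with an action of `G` and a pairing `G × G → L` obeying the identities of the
nonabelian exterior square. -/
structure CrossedPairing (G L : Type*) [Group G] [Group L] where
  act : G →* MulAut L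
  br : G → G → L
  br_mul_left (u v w : G) : br (u * v) w = act u (br v w) * br u w
  br_mul_right (u v w : G) : br u (v * w) = br u v * act v (br u w)
  br_self (u : G) : br u u = 1
  br_anti (u v : G) : br v u = (br u v)⁻¹
  peiffer (u v : G) (l : L) : br u v * l * (br u v)⁻¹ = act (u * v * u⁻¹ * v⁻¹) l
  br_swap (u v a : G) : br (u * v) a = br u v * br (v * u) a * (act a (br u v))⁻¹

section OrdProd

variable {S G : Type*} [LinearOrder S] [Group G]

open scoped Classical in
/-- The product of the powers `g s ^ m s`, `s ∈ I`, in increasing order of `s`. -/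
noncomputable def ordProd (g : S → G) (I : Set S) (m : S →₀ ℤ) : G :=
  (((m.support.filter (· ∈ I)).sort (· ≤ ·)).map fun s => g s ^ m s).prod

theorem ordProd_eq (g : S → G) (I : Set S) (m : S →₀ ℤ) (A : Finset S)
    (hA : ∀ s, s ∈ A ↔ m s ≠ 0 ∧ s ∈ I) :
    ordProd g I m = ((A.sort (· ≤ ·)).map fun s => g s ^ m s).prod := by
  classical
  have : A = m.support.filter (· ∈ I) := by
    ext s
    simp [hA]
  subst this
  rfl

theorem ordProd_congr (g : S → G) (I : Set S) {m m' : S →₀ ℤ} (h : ∀ s ∈ I, m s = m' s) :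
    ordProd g I m = ordProd g I m' := by
  classical
  have hs : m.support.filter (· ∈ I) = m'.support.filter (· ∈ I) := by
    ext s
    simp only [Finset.mem_filter, Finsupp.mem_support_iff]
    constructor <;> rintro ⟨h1, h2⟩ <;> refine ⟨?_, h2⟩
    · rwa [← h s h2]
    · rwa [h s h2]
  unfold ordProd
  rw [hs]
  refine congrArg List.prod (List.map_congr_left fun s hs => ?_)
  rw [Finset.mem_sort, Finset.mem_filter] at hs
  rw [h s hs.2]

theorem ordProd_union (g : S → G) {I J : Set S} (h : ∀ a ∈ I, ∀ b ∈ J, a < b) (m : S →₀ ℤ) :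
    ordProd g (I ∪ J) m = ordProd g I m * ordProd g J m := by
  classical
  unfold ordProd
  rw [← List.prod_append, ← List.map_append]
  congr 2
  refine List.Perm.eq_of_pairwise' (r := (· ≤ ·)) (Finset.pairwise_sort _ _) ?_ ?_
  · rw [List.pairwise_append]
    refine ⟨Finset.pairwise_sort _ _, Finset.pairwise_sort _ _, fun a ha b hb => ?_⟩
    simp only [Finset.mem_sort, Finset.mem_filter] at ha hb
    exact (h a ha.2 b hb.2).le
  · rw [← Multiset.coe_eq_coe, ← Multiset.coe_add, Finset.sort_eq, Finset.sort_eq, Finset.sort_eq]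
    have hd : Disjoint (m.support.filter (· ∈ I)) (m.support.filter (· ∈ J)) := by
      rw [Finset.disjoint_left]
      intro a ha hb
      simp only [Finset.mem_filter] at ha hb
      exact lt_irrefl a (h a ha.2 a hb.2)
    rw [← Finset.disjUnion_val _ _ hd, Finset.disjUnion_eq_union, ← Finset.filter_or]
    simp only [Set.mem_union]

theorem ordProd_singleton (g : S → G) (s : S) (m : S →₀ ℤ) :
    ordProd g {s} m = g s ^ m s := by
  by_cases hs : m s = 0
  · rw [ordProd_eq g {s} m ∅, hs]
    · simp
    · simp only [Finset.notMem_empty, Set.mem_singleton_iff, false_iff, not_and]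
      rintro t ht rfl
      exact ht hs
  · rw [ordProd_eq g {s} m {s}]
    · simp
    · simp only [Finset.mem_singleton, Set.mem_singleton_iff]
      exact fun t => ⟨fun h => ⟨h ▸ hs, h⟩, fun h => h.2⟩

theorem ordProd_Iio_add_of_le (g : S → G) {u v : S} (h : u ≤ v) (m : S →₀ ℤ) :
    ordProd g (Set.Iio u) (m + Finsupp.single v 1) = ordProd g (Set.Iio u) m := by
  refine ordProd_congr g _ fun s hs => ?_
  have : v ≠ s := (lt_of_lt_of_le hs h).ne'
  simp [this]

/-- Raising the exponent of `u` inserts one factor `g u` right after the block of factors below `u`;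
`c` collects the factors from `u` up to but excluding `v`. -/
theorem ordProd_Iio_split (g : S → G) {u v : S} (h : u < v) (m : S →₀ ℤ) :
    ∃ c, ordProd g (Set.Iio v) m = ordProd g (Set.Iio u) m * c ∧
      ordProd g (Set.Iio v) (m + Finsupp.single u 1) = ordProd g (Set.Iio u) m * (g u * c) := by
  have hset : Set.Iio v = Set.Iio u ∪ ({u} ∪ Set.Ioo u v) := by
    ext s
    simp only [Set.mem_Iio, Set.mem_union, Set.mem_singleton_iff, Set.mem_Ioo]
    constructor
    · intro hs
      rcases lt_trichotomy s u with h1 | h1 | h1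
      · exact Or.inl h1
      · exact Or.inr (Or.inl h1)
      · exact Or.inr (Or.inr ⟨h1, hs⟩)
    · rintro (h1 | h1 | h1)
      · exact h1.trans h
      · exact h1 ▸ h
      · exact h1.2
  have key : ∀ m', ordProd g (Set.Iio v) m' =
      ordProd g (Set.Iio u) m' * (g u ^ m' u * ordProd g (Set.Ioo u v) m') := by
    intro m'
    rw [hset, ordProd_union, ordProd_union, ordProd_singleton]
    · rintro a rfl b hb
      exact hb.1
    · rintro a ha b (hb | hb)
      · exact hb ▸ ha
      · exact lt_trans ha hb.1
  refine ⟨_, key m, ?_⟩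
  rw [key, ordProd_Iio_add_of_le g le_rfl]
  have : ordProd g (Set.Ioo u v) (m + Finsupp.single u 1) = ordProd g (Set.Ioo u v) m := by
    refine ordProd_congr g _ fun s hs => ?_
    have : u ≠ s := hs.1.ne
    simp [this]
  rw [this]
  simp [zpow_add, ← mul_assoc, (Commute.self_zpow (g u) (m u)).eq]

end OrdProd

namespace CrossedPairing

/-- Left multiplication by elements of `L` on `L × (G →₀ ℤ)`. -/
noncomputable def leftMul (G L : Type*) [Group L] :
    L →* Equiv.Perm (L × (G →₀ ℤ)) where
  toFun l := (Equiv.mulLeft l).prodCongr (Equiv.refl _)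
  map_one' := by ext <;> simp
  map_mul' a b := by ext <;> simp [mul_assoc]

theorem leftMul_injective (G L : Type*) [Group L] : Function.Injective (leftMul G L) := by
  intro a b h
  have := congrArg Prod.fst (DFunLike.congr_fun h ((1 : L), (0 : G →₀ ℤ)))
  simpa [leftMul] using this

variable {G L : Type*} [Group G] [Group L] (P : CrossedPairing G L)

theorem br_one_left (v : G) : P.br 1 v = 1 := by
  have := P.br_mul_left 1 1 v
  simpa using this

theorem br_one_right (v : G) : P.br v 1 = 1 := by
  rw [P.br_anti, br_one_left, inv_one]

theorem br_mul_comm (u v : G) (l : L) :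
    P.br u v * P.act (v * u) l = P.act (u * v) l * P.br u v := by
  have h := P.peiffer u v (P.act (v * u) l)
  rw [← MulAut.mul_apply, ← map_mul] at h
  rw [mul_inv_eq_iff_eq_mul] at h
  rw [h]
  congr 3
  group

/-- This is the compatibility that makes the lifts of `u < v` commute up to `br u v`: here `a` is
the product of the factors below `u` and `a * c` that of the factors below `v`, before and after a
factor `u` is inserted. It is where `br_swap` enters. -/
theorem shuffle (u v a c : G) :
    P.act u (P.br v (a * c)) * P.br u a =
      P.br u v * (P.act v (P.br u a) * P.br v (a * (u * c))) := by
  have h1 : P.act u (P.br v (a * c)) * P.br u a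
      = P.br (u * v) a * P.act (a * u) (P.br v c) := by
    rw [P.br_mul_right v a c, map_mul, mul_assoc, ← MulAut.mul_apply, ← map_mul,
      ← P.br_mul_comm u a, ← mul_assoc, P.br_mul_left u v a]
  rw [h1, P.br_mul_right v a, P.br_mul_right v u c, P.br_swap u v a, P.br_mul_left v u a,
    P.br_anti u v]
  simp only [map_mul, map_inv, MulAut.mul_apply, mul_assoc]

variable [LinearOrder G]

/-- Left multiplication by a lift of `u` in the extension of `G` on the set `L × (G →₀ ℤ)`. -/
noncomputable def leftLift (u : G) : Equiv.Perm (L × (G →₀ ℤ)) where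
  -- A pair `(l, m)` stands for the normal form `l` times the ordered product of lifts with
  -- exponents `m`. A lift of `u` put in front acts on `l`, then moves right past the lifts of
  -- smaller elements, at the cost of its bracket with their product.
  toFun y := (P.act u y.1 * P.br u (ordProd id (Set.Iio u) y.2), y.2 + Finsupp.single u 1)
  invFun y := ((P.act u)⁻¹ (y.1 * (P.br u (ordProd id (Set.Iio u) (y.2 - Finsupp.single u 1)))⁻¹),
    y.2 - Finsupp.single u 1)
  left_inv y := by simp
  right_inv y := by simp

theorem leftLift_mul_leftMul (u : G) (l : L) :
    P.leftLift u * leftMul G L l * (P.leftLift u)⁻¹ = leftMul G L (P.act u l) := by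
  rw [mul_inv_eq_iff_eq_mul]
  ext y
  · simp [leftLift, leftMul, mul_assoc]
  · simp [leftLift, leftMul]

theorem leftLift_commutator_of_lt {u v : G} (h : u < v) :
    P.leftLift u * P.leftLift v = leftMul G L (P.br u v) * (P.leftLift v * P.leftLift u) := by
  refine Equiv.ext fun y => ?_
  obtain ⟨c, hc1, hc2⟩ := ordProd_Iio_split (G := G) id h y.2
  refine Prod.ext ?_ ?_
  · simp only [leftLift, leftMul, Equiv.Perm.coe_mul, Function.comp_apply, Equiv.coe_fn_mk,
      MonoidHom.coe_mk, OneHom.coe_mk, Equiv.prodCongr_apply, Prod.map_apply, Equiv.coe_mulLeft]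
    rw [ordProd_Iio_add_of_le id h.le, hc1, hc2, map_mul, map_mul, mul_assoc,
      P.shuffle u v, id, ← MulAut.mul_apply, ← MulAut.mul_apply, ← map_mul, ← map_mul,
      ← mul_assoc, ← P.br_mul_comm]
    simp only [mul_assoc]
  · simp [leftLift, leftMul, add_right_comm]

theorem leftLift_commutator (u v : G) :
    P.leftLift u * P.leftLift v = leftMul G L (P.br u v) * (P.leftLift v * P.leftLift u) := by
  rcases lt_trichotomy u v with h | rfl | h
  · exact P.leftLift_commutator_of_lt h
  · simp [P.br_self]
  · rw [P.br_anti v u, map_inv, P.leftLift_commutator_of_lt h, inv_mul_cancel_left]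

/-- The group generated by the lifts of the elements of `G`. -/
def liftGroup : Subgroup (Equiv.Perm (L × (G →₀ ℤ)) × G) :=
  Subgroup.closure (Set.range fun u => (P.leftLift u, u))

theorem liftGroup_conj {x : Equiv.Perm (L × (G →₀ ℤ)) × G} (hx : x ∈ P.liftGroup) (l : L) :
    x.1 * leftMul G L l * x.1⁻¹ = leftMul G L (P.act x.2 l) := by
  induction hx using Subgroup.closure_induction generalizing l with
  | mem x hx =>
    obtain ⟨u, rfl⟩ := hx
    exact P.leftLift_mul_leftMul u l
  | one => simp
  | mul x y _ _ hx hy =>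
    rw [Prod.fst_mul, Prod.snd_mul, map_mul, MulAut.mul_apply, ← hx, ← hy]
    group
  | inv x _ hx =>
    have := hx (P.act x.2⁻¹ l)
    rw [← MulAut.mul_apply, ← map_mul, mul_inv_cancel, map_one, MulAut.one_apply] at this
    rw [Prod.fst_inv, Prod.snd_inv, ← this]
    group

/-- The commutator formula extends from generators because both sides expand by the same
biderivation rules, with `act` realized as conjugation. For `x.2 = 1` the bracket is trivial, so the
kernel of the projection to `G` is central. -/
theorem liftGroup_commutator {x y : Equiv.Perm (L × (G →₀ ℤ)) × G}
    (hx : x ∈ P.liftGroup) (hy : y ∈ P.liftGroup) :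
    x.1 * y.1 = leftMul G L (P.br x.2 y.2) * (y.1 * x.1) := by
  induction hy using Subgroup.closure_induction with
  | mem y hy =>
    obtain ⟨v, rfl⟩ := hy
    induction hx using Subgroup.closure_induction with
    | mem x hx =>
      obtain ⟨u, rfl⟩ := hx
      exact P.leftLift_commutator u v
    | one => simp [P.br_one_left]
    | mul x y hx' _ hx hy =>
      simp only [Prod.fst_mul, Prod.snd_mul] at *
      rw [mul_assoc, hy, P.br_mul_left, map_mul, ← P.liftGroup_conj hx']
      have h2 : leftMul G L (P.br x.2 v) * (P.leftLift v * (x.1 * y.1))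
          = x.1 * (P.leftLift v * y.1) := by
        rw [← mul_assoc, ← mul_assoc, mul_assoc (leftMul G L _), ← hx, mul_assoc]
      rw [mul_assoc, h2]
      simp only [mul_assoc, inv_mul_cancel_left]
    | inv x hx' hx =>
      simp only [Prod.fst_inv, Prod.snd_inv] at *
      have h1 : P.br x.2⁻¹ v = (P.act x.2⁻¹ (P.br x.2 v))⁻¹ := by
        have := P.br_mul_left x.2⁻¹ x.2 v
        rw [inv_mul_cancel, P.br_one_left] at this
        exact eq_inv_of_mul_eq_one_right this.symm
      rw [h1, map_inv, ← Prod.snd_inv, ← P.liftGroup_conj (inv_mem hx')]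
      simp only [Prod.fst_inv, mul_inv_rev, inv_inv, mul_assoc]
      rw [inv_mul_eq_iff_eq_mul]
      simp only [mul_inv_cancel_left]
      rw [eq_inv_mul_iff_mul_eq, ← mul_assoc, eq_mul_inv_iff_mul_eq, hx, mul_assoc]
  | one => simp [P.br_one_right]
  | mul y z hy' _ hy hz =>
    simp only [Prod.fst_mul, Prod.snd_mul] at *
    rw [P.br_mul_right, map_mul, ← P.liftGroup_conj hy', ← mul_assoc, hy]
    simp only [mul_assoc, inv_mul_cancel_left]
    rw [hz]
  | inv y hy' hy =>
    simp only [Prod.fst_inv, Prod.snd_inv] at *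
    have h1 : P.br x.2 y.2⁻¹ = (P.act y.2⁻¹ (P.br x.2 y.2))⁻¹ := by
      have := P.br_mul_right x.2 y.2⁻¹ y.2
      rw [inv_mul_cancel, P.br_one_right] at this
      exact eq_inv_of_mul_eq_one_left this.symm
    rw [h1, map_inv, ← Prod.snd_inv, ← P.liftGroup_conj (inv_mem hy')]
    simp only [Prod.fst_inv, mul_inv_rev, inv_inv, mul_assoc, mul_inv_cancel_left]
    have h2 : (leftMul G L (P.br x.2 y.2))⁻¹ * x.1 = y.1 * x.1 * y.1⁻¹ := by
      rw [inv_mul_eq_iff_eq_mul, ← mul_assoc, ← hy, mul_inv_cancel_right]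
    rw [h2]
    group

end CrossedPairing
end ParamSym

/-! ### 2-chains modulo boundaries and the second homology inside them -/

namespace ParamSym

/-- The ring of integers in the universe `u`. -/
abbrev ZU : Type u := ULift.{u} ℤ

/-- The trivial integral representation. -/
noncomputable abbrev trivRep (G : Type u) [Group G] : Rep.{u} ZU.{u} G := Rep.trivial ZU G ZU

/-- Inhomogeneous 2-chains modulo boundaries. -/
abbrev ChainQuot (G : Type u) [Group G] : Type u :=
  (G × G →₀ ZU.{u}) ⧸ (groupHomology.boundaries₂ (trivRep G) : Submodule ZU (G × G →₀ ZU))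

/-- The differential from 2-chains modulo boundaries to 1-chains. -/
noncomputable def chainD (G : Type u) [Group G] : ChainQuot G →ₗ[ZU.{u}] (G →₀ ZU.{u}) :=
  Submodule.liftQ _ (groupHomology.d₂₁ (trivRep G)).hom
    (groupHomology.boundaries₂_le_cycles₂ (trivRep G))

variable {G : Type u} [Group G]

/-- The tautological 2-cocycle. -/
noncomputable def coc (g h : G) : ChainQuot G := Submodule.Quotient.mk (Finsupp.single (g, h) 1)

theorem chainD_coc (g h : G) : chainD G (coc g h) =
    Finsupp.single h 1 - Finsupp.single (g * h) 1 + Finsupp.single g 1 := by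
  exact groupHomology.d₂₁_single (A := trivRep G) (g, h) (1 : ZU)

theorem coc_cocycle (g h j : G) : coc h j + coc g (h * j) = coc (g * h) j + coc g h := by
  have h1 : (Finsupp.single (h, j) 1 - Finsupp.single (g * h, j) 1 + Finsupp.single (g, h * j) 1
      - Finsupp.single (g, h) 1 : G × G →₀ ZU.{u}) ∈ groupHomology.boundaries₂ (trivRep G) :=
    ⟨Finsupp.single (g, h, j) 1, groupHomology.d₃₂_single (A := trivRep G) (g, h, j) (1 : ZU)⟩
  have h2 : coc h j - coc (g * h) j + coc g (h * j) - coc g h = 0 :=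
    (Submodule.Quotient.mk_eq_zero _).2 h1
  have h3 : coc h j + coc g (h * j) - (coc (g * h) j + coc g h) = 0 := by
    rw [← h2]; abel
  exact sub_eq_zero.1 h3

theorem coc_one_left (g : G) : coc 1 g = coc (1 : G) 1 := by
  have := coc_cocycle 1 1 g
  simp only [one_mul, add_right_inj] at this
  exact this

theorem coc_one_right (g : G) : coc g 1 = coc (1 : G) 1 := by
  have := coc_cocycle g 1 1
  simp only [mul_one] at this
  exact (add_right_cancel this).symm

theorem chainQuot_induction {p : ChainQuot G → Prop} (z : ChainQuot G)
    (coc' : ∀ g h, p (coc g h)) (add : ∀ a b, p a → p b → p (a + b)) (neg : ∀ a, p a → p (-a))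
    (zero : p 0) : p z := by
  obtain ⟨z, rfl⟩ := Submodule.Quotient.mk_surjective _ z
  induction z using Finsupp.induction_linear with
  | zero => exact zero
  | add x y hx hy => exact add _ _ hx hy
  | single x a =>
    obtain ⟨g, h⟩ := x
    obtain ⟨n⟩ := a
    have : (Submodule.Quotient.mk (Finsupp.single (g, h) (ULift.up n)) : ChainQuot G)
        = n • coc g h := by
      have h1 : (Finsupp.single (g, h) (ULift.up n) : G × G →₀ ZU.{u})
          = n • Finsupp.single (g, h) 1 := by
        rw [Finsupp.smul_single]
        congr 1
        ext
        simp
      rw [h1]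
      rfl
    rw [this]
    clear this
    induction n using Int.induction_on with
    | zero => simpa using zero
    | succ i hi => rw [add_smul, one_smul]; exact add _ _ hi (coc' g h)
    | pred i hi => rw [sub_smul, one_smul, sub_eq_add_neg]; exact add _ _ hi (neg _ (coc' g h))

/-- The boundary of a basis 3-chain is the cocycle identity. This is what makes `coc` universal:
every 2-cocycle with trivial action factors through `ChainQuot G`. -/
theorem boundaries_le_ker {A : Type*} [AddCommGroup A] [Module ZU.{u} A]
    (lin : (G × G →₀ ZU.{u}) →ₗ[ZU.{u}] A)
    (h : ∀ g h j, lin (Finsupp.single (h, j) 1) + lin (Finsupp.single (g, h * j) 1) =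
      lin (Finsupp.single (g * h, j) 1) + lin (Finsupp.single (g, h) 1)) :
    groupHomology.boundaries₂ (trivRep G) ≤ LinearMap.ker lin := by
  have hlin : lin ∘ₗ (groupHomology.d₃₂ (trivRep G)).hom = 0 := by
    refine Finsupp.lhom_ext' fun y => LinearMap.ext_ring ?_
    obtain ⟨g, k, j⟩ := y
    have h1 : (groupHomology.d₃₂ (trivRep G)).hom (Finsupp.single (g, k, j) (1 : ZU.{u})) =
        (Finsupp.single (k, j) 1 - Finsupp.single (g * k, j) 1 + Finsupp.single (g, k * j) 1
          - Finsupp.single (g, k) 1 : G × G →₀ ZU.{u}) :=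
      groupHomology.d₃₂_single (A := trivRep G) (g, k, j) (1 : ZU)
    change lin ((groupHomology.d₃₂ (trivRep G)).hom (Finsupp.single (g, k, j) (1 : ZU.{u}))) = 0
    rw [h1, map_sub, map_add, map_sub]
    rw [← sub_eq_zero.2 (h g k j)]
    abel
  rintro _ ⟨y, rfl⟩
  exact DFunLike.congr_fun hlin y

/-- The map of 2-chains modulo boundaries induced by a homomorphism. -/
noncomputable def chainQuotMap {G' : Type u} [Group G'] (f : G →* G') :
    ChainQuot G →ₗ[ZU.{u}] ChainQuot G' :=
  Submodule.liftQ _ ((Submodule.mkQ _).comp (Finsupp.lmapDomain ZU ZU (Prod.map f f)))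
    (boundaries_le_ker _ fun g h j => by
      have := coc_cocycle (f g) (f h) (f j)
      simpa [coc] using this)

theorem chainQuotMap_mk {G' : Type u} [Group G'] (f : G →* G') (z : G × G →₀ ZU.{u}) :
    chainQuotMap f (Submodule.Quotient.mk z) =
      Submodule.Quotient.mk (Finsupp.mapDomain (Prod.map f f) z) := rfl

theorem chainQuotMap_coc {G' : Type u} [Group G'] (f : G →* G') (g h : G) :
    chainQuotMap f (coc g h) = coc (f g) (f h) := by
  rw [coc, chainQuotMap_mk, Finsupp.mapDomain_single]
  rfl

/-- The inclusion of the second homology into 2-chains modulo boundaries. -/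
noncomputable def homologyInc (G : Type u) [Group G] : H2 ZU.{u} G →ₗ[ZU.{u}] ChainQuot G :=
  (Submodule.liftQ (LinearMap.ker (groupHomology.H2π (trivRep G)).hom)
    ((Submodule.mkQ (groupHomology.boundaries₂ (trivRep G))).comp
      (groupHomology.cycles₂ (trivRep G)).subtype) (by
        intro z hz
        exact (Submodule.Quotient.mk_eq_zero _).2 ((groupHomology.H2π_eq_zero_iff z).1 hz))).comp
    ((groupHomology.H2π (trivRep G)).hom.quotKerEquivOfSurjective
      ((ModuleCat.epi_iff_surjective _).1 inferInstance)).symm.toLinearMap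

theorem homologyInc_H2π (z : groupHomology.cycles₂ (trivRep G)) :
    homologyInc G ((groupHomology.H2π (trivRep G)).hom z) =
      (Submodule.Quotient.mk z.1 : ChainQuot G) := by
  have h : ((groupHomology.H2π (trivRep G)).hom.quotKerEquivOfSurjective
      ((ModuleCat.epi_iff_surjective _).1 inferInstance)).symm
        ((groupHomology.H2π (trivRep G)).hom z) = Submodule.Quotient.mk z := by
    rw [LinearEquiv.symm_apply_eq]
    rfl
  rw [homologyInc, LinearMap.comp_apply, LinearEquiv.coe_coe, h]
  rfl

theorem homologyInc_injective : Function.Injective (homologyInc G) := by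
  rw [injective_iff_map_eq_zero]
  intro z hz
  induction z using groupHomology.H2_induction_on with
  | h z =>
    have := (homologyInc_H2π z).symm.trans hz
    exact (groupHomology.H2π_eq_zero_iff z).2 ((Submodule.Quotient.mk_eq_zero _).1 this)

theorem chainD_homologyInc (z : H2 ZU.{u} G) : chainD G (homologyInc G z) = 0 := by
  induction z using groupHomology.H2_induction_on with
  | h z => exact (congrArg (chainD G) (homologyInc_H2π z)).trans z.2

theorem exists_homologyInc {z : ChainQuot G} (hz : chainD G z = 0) : ∃ y, homologyInc G y = z := by
  obtain ⟨z, rfl⟩ := Submodule.Quotient.mk_surjective _ z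
  exact ⟨_, homologyInc_H2π ⟨z, hz⟩⟩

theorem homologyInc_H2map {G' : Type u} [Group G'] (f : G →* G') (z : H2 ZU.{u} G) :
    homologyInc G' (H2map ZU f z) = chainQuotMap f (homologyInc G z) := by
  induction z using groupHomology.H2_induction_on with
  | h z =>
    have h1 := groupHomology.H2π_comp_map_apply (A := trivRep G) (B := trivRep G') f
      (CategoryTheory.CategoryStruct.id (trivRep G)) z
    refine (congrArg (homologyInc G') h1).trans ?_
    refine (homologyInc_H2π _).trans ?_
    refine Eq.trans ?_ (congrArg (chainQuotMap f) (homologyInc_H2π z)).symm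
    rw [chainQuotMap_mk]
    congr 1
    refine Eq.trans (b := Finsupp.mapRange (id : ZU.{u} → ZU.{u}) rfl
      (Finsupp.mapDomain (Prod.map f f) (z.1 : G × G →₀ ZU.{u}))) rfl ?_
    exact Finsupp.mapRange_id _

/-! ### The tautological central extension -/

/-- The central extension of `G` by 2-chains modulo boundaries. -/
@[ext]
structure TautExt (G : Type u) [Group G] : Type u where
  cen : ChainQuot G
  val : G

namespace TautExt

noncomputable instance : Mul (TautExt G) :=
  ⟨fun a b => ⟨a.cen + b.cen + coc a.val b.val, a.val * b.val⟩⟩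
noncomputable instance : One (TautExt G) := ⟨⟨-coc 1 1, 1⟩⟩
noncomputable instance : Inv (TautExt G) :=
  ⟨fun a => ⟨-a.cen - coc 1 1 - coc a.val⁻¹ a.val, a.val⁻¹⟩⟩

theorem mul_cen (a b : TautExt G) : (a * b).cen = a.cen + b.cen + coc a.val b.val := rfl
theorem mul_val (a b : TautExt G) : (a * b).val = a.val * b.val := rfl
theorem one_cen : (1 : TautExt G).cen = -coc 1 1 := rfl
theorem one_val : (1 : TautExt G).val = 1 := rfl
theorem inv_cen (a : TautExt G) : (a⁻¹).cen = -a.cen - coc 1 1 - coc a.val⁻¹ a.val := rfl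
theorem inv_val (a : TautExt G) : (a⁻¹).val = a.val⁻¹ := rfl

noncomputable instance : Group (TautExt G) :=
  Group.ofLeftAxioms
    (fun a b c => TautExt.ext (by
      have := coc_cocycle a.val b.val c.val
      simp only [mul_cen, mul_val]
      rw [add_assoc (a.cen + _), add_assoc a.cen, add_assoc a.cen, add_assoc a.cen,
        add_assoc (b.cen + _), this]
      abel) (mul_assoc _ _ _))
    (fun a => TautExt.ext (by simp [mul_cen, one_cen, one_val, coc_one_left]) (one_mul _))
    (fun a => TautExt.ext (by
      simp only [mul_cen, inv_cen, inv_val, one_cen]; abel) (inv_mul_cancel _))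

/-- The projection to `G`. -/
noncomputable def proj (G : Type u) [Group G] : TautExt G →* G where
  toFun := val
  map_one' := rfl
  map_mul' _ _ := rfl

/-- The tautological section. -/
noncomputable def sec (g : G) : TautExt G := ⟨0, g⟩

theorem proj_sec (g : G) : proj G (sec g) = g := rfl

/-- The inclusion of the central kernel. -/
noncomputable def inc (G : Type u) [Group G] : Multiplicative (ChainQuot G) →* TautExt G where
  toFun m := ⟨m.toAdd - coc 1 1, 1⟩
  map_one' := TautExt.ext (by simp [one_cen]) rfl
  map_mul' a b := TautExt.ext (by simp only [mul_cen, toAdd_mul]; abel) (by simp [mul_val])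

theorem inc_injective : Function.Injective (inc G) := by
  intro a b h
  have := congrArg cen h
  simpa [inc] using this

theorem proj_inc (m : Multiplicative (ChainQuot G)) : proj G (inc G m) = 1 := rfl

theorem inc_comm (m : Multiplicative (ChainQuot G)) (x : TautExt G) :
    inc G m * x = x * inc G m := by
  refine TautExt.ext ?_ ?_
  · simp only [mul_cen, inc, MonoidHom.coe_mk, OneHom.coe_mk, coc_one_left, coc_one_right]
    abel
  · simp [mul_val, inc]

theorem eq_inc_mul_sec (x : TautExt G) : x = inc G (Multiplicative.ofAdd x.cen) * sec x.val := by
  refine TautExt.ext ?_ ?_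
  · simp [mul_cen, inc, sec, coc_one_left]
  · simp [mul_val, inc, sec]

theorem exists_inc_of_proj_eq_one {x : TautExt G} (hx : proj G x = 1) : ∃ m, inc G m = x := by
  refine ⟨Multiplicative.ofAdd (x.cen + coc 1 1), TautExt.ext ?_ ?_⟩
  · simp [inc]
  · exact hx.symm

theorem inc_coc (g h : G) :
    inc G (Multiplicative.ofAdd (coc g h)) = sec g * sec h * (sec (g * h))⁻¹ := by
  rw [eq_mul_inv_iff_mul_eq]
  refine TautExt.ext ?_ ?_
  · simp [mul_cen, inc, sec, coc_one_left]
  · simp [mul_val, inc, sec]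

/-- The central kernel is generated by the values of the cocycle, and each of them is an expression
in sections (`inc_coc`). -/
theorem closure_sec : Subgroup.closure (Set.range (sec (G := G))) = ⊤ := by
  rw [eq_top_iff]
  intro x _
  have hs : ∀ g : G, sec g ∈ Subgroup.closure (Set.range (sec (G := G))) :=
    fun g => Subgroup.subset_closure ⟨g, rfl⟩
  rw [eq_inc_mul_sec x]
  refine mul_mem ?_ (hs _)
  induction x.cen using chainQuot_induction with
  | coc' g h =>
    rw [inc_coc]
    exact mul_mem (mul_mem (hs _) (hs _)) (inv_mem (hs _))
  | add a b ha hb =>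
    rw [ofAdd_add, map_mul]
    exact mul_mem ha hb
  | neg a ha =>
    rw [ofAdd_neg, map_inv]
    exact inv_mem ha
  | zero => rw [ofAdd_zero, map_one]; exact one_mem _

theorem hom_ext {K : Type*} [Group K] {α β : TautExt G →* K} (h : ∀ g, α (sec g) = β (sec g)) :
    α = β :=
  MonoidHom.eq_of_eqOn_dense closure_sec (by rintro _ ⟨g, rfl⟩; exact h g)

/-- `TautExt G` maps to every central extension of `G` with a section. -/
theorem exists_hom {K : Type*} [Group K] (p : K →* G) (x : G → K) (hx : ∀ g, p (x g) = g)
    (hc : ∀ a b, p a = 1 → a * b = b * a) :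
    ∃ α : TautExt G →* K, ∀ g, α (sec g) = x g := by
  let _ : CommGroup (Subgroup.center K) :=
    { (inferInstance : Group (Subgroup.center K)) with
      mul_comm := fun a b => Subtype.ext (Subgroup.mem_center_iff.1 b.2 a) }
  -- The factor set of the section `x`; it is a 2-cocycle by associativity, so its linear extension
  -- descends to `ChainQuot G`.
  let c : G × G → Additive (Subgroup.center K) := fun y => Additive.ofMul
    ⟨x y.1 * x y.2 * (x (y.1 * y.2))⁻¹,
      Subgroup.mem_center_iff.2 fun b => (hc _ b (by simp [hx])).symm⟩
  have hcoc : ∀ a b, x a * x b = ((c (a, b)).toMul : K) * x (a * b) := by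
    intro a b
    simp [c]
  have hcom : ∀ (a : Additive (Subgroup.center K)) (b : K),
      (a.toMul : K) * b = b * (a.toMul : K) :=
    fun a b => ((Subgroup.mem_center_iff.1 a.toMul.2) b).symm
  have hc2 : ∀ g h j, c (h, j) + c (g, h * j) = c (g * h, j) + c (g, h) := by
    intro g h j
    apply Additive.toMul.injective
    apply Subtype.ext
    apply mul_right_cancel (b := x (g * h * j))
    have h1 : x g * x h * x j = ((c (g * h, j)).toMul : K) * (c (g, h)).toMul * x (g * h * j) := by
      rw [hcoc g h, mul_assoc, hcoc, ← mul_assoc, hcom (c (g * h, j))]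
    have h2 : x g * x h * x j = ((c (h, j)).toMul : K) * (c (g, h * j)).toMul * x (g * h * j) := by
      rw [mul_assoc, hcoc h j, ← mul_assoc, ← hcom, mul_assoc, hcoc g, ← mul_assoc,
        mul_assoc g h j]
    exact h2.symm.trans h1
  let lin : (G × G →₀ ZU.{u}) →ₗ[ZU.{u}] Additive (Subgroup.center K) :=
    Finsupp.linearCombination ZU c
  let β : ChainQuot G →ₗ[ZU.{u}] Additive (Subgroup.center K) :=
    Submodule.liftQ _ lin (boundaries_le_ker lin fun g h j => by
      simpa only [lin, Finsupp.linearCombination_single, one_smul] using hc2 g h j)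
  have hβ : ∀ g h, β (coc g h) = c (g, h) := by
    intro g h
    change lin (Finsupp.single (g, h) 1) = _
    simp [lin]
  have hadd : ∀ a b, ((β (a + b)).toMul : K) = (β a).toMul * (β b).toMul := by
    intro a b
    rw [β.map_add]
    rfl
  refine ⟨MonoidHom.mk' (fun y => ((β y.cen).toMul : K) * x y.val) fun y z => ?_, fun g => ?_⟩
  · rw [mul_cen, mul_val, hadd, hadd, hβ, mul_assoc, ← hcoc, ← mul_assoc,
      mul_assoc ((β y.cen).toMul : K), hcom (β z.cen) (x y.val)]
    simp only [mul_assoc]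
  · simp [sec]

/-- The homomorphism to 1-chains extending the differential. -/
noncomputable def eps (G : Type u) [Group G] : TautExt G →* Multiplicative (G →₀ ZU.{u}) :=
  MonoidHom.mk' (fun x => Multiplicative.ofAdd (chainD G x.cen + Finsupp.single x.val 1))
    fun x y => by
      rw [← ofAdd_add, mul_cen, mul_val, (chainD G).map_add, (chainD G).map_add, chainD_coc]
      congr 1
      abel

theorem eps_inc (m : Multiplicative (ChainQuot G)) :
    eps G (inc G m) = Multiplicative.ofAdd (chainD G m.toAdd) := by
  simp [eps, inc, chainD_coc]

theorem eps_sec (g : G) : eps G (sec g) = Multiplicative.ofAdd (Finsupp.single g 1) := by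
  simp [eps, sec]

/-- The abelianization map factors through `eps`: send the basis element at `g` to the class of `sec
g`, and compare on sections, which generate. -/
theorem mem_commutator_of_eps_eq_one {x : TautExt G} (hx : eps G x = 1) :
    x ∈ commutator (TautExt G) := by
  let κ : Multiplicative (G →₀ ZU.{u}) →* Abelianization (TautExt G) :=
    AddMonoidHom.toMultiplicativeLeft (Finsupp.linearCombination ZU.{u}
      fun g : G => Additive.ofMul (Abelianization.of (sec g))).toAddMonoidHom
  have h : κ.comp (eps G) = Abelianization.of := by
    refine hom_ext fun g => ?_
    simp [κ, eps_sec]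
  rw [← Abelianization.ker_of, MonoidHom.mem_ker, ← h, MonoidHom.comp_apply, hx, map_one]

/-- The homomorphism of extensions induced by a homomorphism. -/
noncomputable def map {G' : Type u} [Group G'] (f : G →* G') : TautExt G →* TautExt G' :=
  MonoidHom.mk' (fun x => ⟨chainQuotMap f x.cen, f x.val⟩) fun x y => TautExt.ext
    (by simp [mul_cen, chainQuotMap_coc]) (by simp [mul_val])

theorem map_sec {G' : Type u} [Group G'] (f : G →* G') (g : G) : map f (sec g) = sec (f g) := by
  simp [map, sec]

theorem map_inc {G' : Type u} [Group G'] (f : G →* G') (m : Multiplicative (ChainQuot G)) :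
    map f (inc G m) = inc G' (Multiplicative.ofAdd (chainQuotMap f m.toAdd)) := by
  simp [map, inc, chainQuotMap_coc]

/-- A crossed pairing on `G` is realized by commutators in a quotient of `TautExt G`. -/
theorem exists_hom_of_crossedPairing {L : Type*} [Group L] (P : CrossedPairing G L) :
    ∃ (α : TautExt G →* Equiv.Perm (L × (G →₀ ℤ))) (j : L →* Equiv.Perm (L × (G →₀ ℤ))),
      Function.Injective j ∧
        ∀ u v, α (sec u * sec v * (sec u)⁻¹ * (sec v)⁻¹) = j (P.br u v) := by
  classical
  -- Normal forms need some linear order on `G`; it need not be compatible with multiplication.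
  let _ : LinearOrder G := IsWellOrder.linearOrder WellOrderingRel
  have hmem : ∀ u, (P.leftLift u, u) ∈ P.liftGroup := fun u => Subgroup.subset_closure ⟨u, rfl⟩
  obtain ⟨α, hα⟩ := exists_hom (K := P.liftGroup)
    ((MonoidHom.snd _ _).comp P.liftGroup.subtype) (fun u => ⟨(P.leftLift u, u), hmem u⟩)
    (fun u => rfl) (by
      rintro ⟨a, ha⟩ ⟨b, hb⟩ h
      have h' : a.2 = 1 := h
      refine Subtype.ext (Prod.ext ?_ ?_)
      · have := P.liftGroup_commutator ha hb
        rwa [h', P.br_one_left, map_one, one_mul] at this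
      · simp [h'])
  refine ⟨((MonoidHom.fst _ _).comp P.liftGroup.subtype).comp α, CrossedPairing.leftMul G L,
    CrossedPairing.leftMul_injective G L, fun u v => ?_⟩
  simp only [map_mul, map_inv, MonoidHom.comp_apply, hα, Subgroup.subtype_apply,
    MonoidHom.coe_fst]
  rw [mul_inv_eq_iff_eq_mul, mul_inv_eq_iff_eq_mul, mul_assoc]
  exact P.leftLift_commutator u v

end TautExt
end ParamSym

/-! ### Algebra of two families `h_ij`, `h_ik`: from Rehmann's relations to a crossed pairing -/

namespace ParamSym

/-- The defect of multiplicativity of `y` (with the order of factors reversed). -/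
def gam {G Q : Type*} [Group G] [Group Q] (y : G → Q) (u v : G) : Q :=
  y (u * v) * (y u)⁻¹ * (y v)⁻¹

/-- The relations between the functions `h_ij` and `h_ik`. -/
structure PairRel {G Q : Type*} [Group G] [Group Q] (x y : G → Q) : Prop where
  conj (u v : G) : x u * y v * (x u)⁻¹ = y (u * v) * (y u)⁻¹
  conj' (u v : G) : y u * x v * (y u)⁻¹ = x (u * v) * (x u)⁻¹
  inv_fst (u : G) : x u⁻¹ = (x u)⁻¹
  inv_snd (u : G) : y u⁻¹ = (y u)⁻¹

namespace PairRel

variable {G Q : Type*} [Group G] [Group Q] {x y : G → Q}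

theorem symm (h : PairRel x y) : PairRel y x := ⟨h.conj', h.conj, h.inv_snd, h.inv_fst⟩

theorem one (h : PairRel x y) : y 1 = 1 := by
  have := h.conj 1 1
  simpa using this

theorem gam_eq (h : PairRel x y) (u v : G) : gam y u v = x u * y v * (x u)⁻¹ * (y v)⁻¹ := by
  rw [h.conj, gam]

theorem gam_flip (h : PairRel x y) (u v : G) : gam x v u = (gam y u v)⁻¹ := by
  rw [h.gam_eq, h.symm.gam_eq]
  group

theorem conj_gam (h : PairRel x y) (w u v : G) :
    x w * gam y u v * (x w)⁻¹ = gam y (w * u) v * (gam y w v)⁻¹ := by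
  have e : x w * gam y u v * (x w)⁻¹ = (x w * y (u * v) * (x w)⁻¹) * (x w * y u * (x w)⁻¹)⁻¹ *
      (x w * y v * (x w)⁻¹)⁻¹ := by rw [gam]; group
  rw [e, h.conj, h.conj, h.conj, gam, gam, mul_assoc w u v]
  group

theorem gam_mul_left (h : PairRel x y) (w u v : G) :
    gam y (w * u) v = x w * gam y u v * (x w)⁻¹ * gam y w v := by
  rw [h.conj_gam, inv_mul_cancel_right]

theorem gam_mul_right (h : PairRel x y) (u w v : G) :
    gam y u (w * v) = gam y u w * (y w * gam y u v * (y w)⁻¹) := by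
  have := h.symm.gam_mul_left w v u
  rw [h.gam_flip, h.gam_flip, h.gam_flip] at this
  rw [← inv_inj, this]
  group

theorem gam_one_left (h : PairRel x y) (v : G) : gam y 1 v = 1 := by simp [gam, h.one]

theorem gam_one_right (h : PairRel x y) (v : G) : gam y v 1 = 1 := by simp [gam, h.one]

theorem gam_inv_self (h : PairRel x y) (u : G) : gam y u⁻¹ u = 1 := by
  simp [gam, h.one, h.inv_snd]

/-- The relation `y u⁻¹ = (y u)⁻¹` kills `gam y u⁻¹ u`; expanding `gam y (u * u⁻¹) u = 1` then
leaves only `gam y u u`. -/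
theorem gam_self (h : PairRel x y) (u : G) : gam y u u = 1 := by
  have := h.gam_mul_left u u⁻¹ u
  rw [h.gam_inv_self, mul_inv_cancel, h.gam_one_left] at this
  simpa using this.symm

theorem commute (h : PairRel x y) (u : G) : x u * y u = y u * x u := by
  have := h.gam_eq u u
  rw [h.gam_self, eq_mul_inv_iff_mul_eq, eq_mul_inv_iff_mul_eq, one_mul] at this
  exact this.symm

theorem gam_inv_left (h : PairRel x y) (u v : G) : gam y u⁻¹ v = (x u)⁻¹ * (gam y u v)⁻¹ * x u := by
  have := h.gam_mul_left u u⁻¹ v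
  rw [mul_inv_cancel, h.gam_one_left, eq_comm, mul_eq_one_iff_eq_inv] at this
  rw [← this]
  group

theorem gam_inv_right (h : PairRel x y) (u v : G) : gam y v u⁻¹ = (y u)⁻¹ * (gam y v u)⁻¹ * y u := by
  have := h.gam_mul_right v u u⁻¹
  rw [mul_inv_cancel, h.gam_one_right, eq_comm, mul_eq_one_iff_inv_eq] at this
  rw [this]
  group

/-- Expand `gam y (u * v) (u * v) = 1` in both variables. Antisymmetry comes out only up to
conjugation by `(x u)⁻¹ * y u`. -/
theorem gam_anti_conj (h : PairRel x y) (u v : G) :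
    (gam y v u)⁻¹ = (x u)⁻¹ * (y u * gam y u v * (y u)⁻¹) * x u := by
  have h1 := h.gam_self (u * v)
  rw [h.gam_mul_left u v, h.gam_mul_right v u v, h.gam_mul_right u u v, h.gam_self, h.gam_self]
    at h1
  simp only [mul_one, mul_inv_cancel, one_mul] at h1
  rw [eq_inv_of_mul_eq_one_right h1]
  group

/-- Passing to `u⁻¹` conjugates one side by `y u` and the other by `x u`. Since `x u` and `y u`
commute, this cancels the conjugation in `gam_anti_conj` exactly, so the claim holds for `u⁻¹`,
hence for every `u`. -/
theorem gam_anti (h : PairRel x y) (u v : G) : gam y v u = (gam y u v)⁻¹ := by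
  have key : ∀ u, gam y v u⁻¹ = (gam y u⁻¹ v)⁻¹ := by
    intro u
    rw [h.gam_inv_right, h.gam_inv_left, h.gam_anti_conj]
    have c := h.commute u
    have c' : (x u)⁻¹ * y u = y u * (x u)⁻¹ := by
      rw [inv_mul_eq_iff_eq_mul, ← mul_assoc, c, mul_inv_cancel_right]
    have c'' : (y u)⁻¹ * (x u)⁻¹ * y u = (x u)⁻¹ := by
      rw [mul_assoc, c', inv_mul_cancel_left]
    have c3 : (y u)⁻¹ * x u * y u = x u := by
      rw [mul_assoc, c, inv_mul_cancel_left]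
    calc (y u)⁻¹ * ((x u)⁻¹ * (y u * gam y u v * (y u)⁻¹) * x u) * y u
        = ((y u)⁻¹ * (x u)⁻¹ * y u) * gam y u v * ((y u)⁻¹ * x u * y u) := by group
      _ = _ := by rw [c'', c3]; group
  have := key u⁻¹
  rwa [inv_inv] at this

theorem gam_eq_gam (h : PairRel x y) (u v : G) : gam x u v = gam y u v := by
  rw [h.gam_flip, ← h.gam_anti]

theorem mul_eq (h : PairRel x y) (u v : G) : x (u * v) = gam y u v * x v * x u := by
  rw [← h.gam_eq_gam, gam]
  group

/-- Write `gam y (u * v) a` as the commutator of `x (u * v) = gam y u v * x v * x u` with `y a`, and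
note that `gam y (v * u) a` is the commutator of `x v * x u` with `y a`. -/
theorem gam_swap (h : PairRel x y) (u v a : G) : gam y (u * v) a =
    gam y u v * gam y (v * u) a * (y a * gam y u v * (y a)⁻¹)⁻¹ := by
  rw [h.gam_mul_left v u a, h.gam_eq (u * v) a, h.mul_eq u v, h.gam_eq u a, h.gam_eq v a]
  group

/-- The two conjugations agree on the values of `gam`. -/
theorem conj_eq (h : PairRel x y) (w u v : G) : x w * gam y u v * (x w)⁻¹ = y w * gam y u v * (y w)⁻¹ := by
  rw [h.conj_gam, ← h.gam_eq_gam u v, h.symm.conj_gam, h.gam_eq_gam, h.gam_eq_gam]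

/-- The subgroup generated by the values of `gam` carries a crossed pairing. -/
theorem exists_crossedPairing (h : PairRel x y) (N : Subgroup Q) [N.Normal]
    (hN : N = Subgroup.closure (Set.range fun p : G × G => gam y p.1 p.2)) :
    ∃ P : CrossedPairing G N, ∀ u v, (P.br u v : Q) = gam y u v := by
  have hmem : ∀ u v, gam y u v ∈ N := fun u v => by
    rw [hN]; exact Subgroup.subset_closure ⟨(u, v), rfl⟩
  have hab : ∀ u, (MulAut.conjNormal (x u) : MulAut N) = MulAut.conjNormal (y u) := by
    intro w
    have : ∀ l ∈ N, x w * l * (x w)⁻¹ = y w * l * (y w)⁻¹ := by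
      intro l hl
      rw [hN] at hl
      induction hl using Subgroup.closure_induction with
      | mem l hl =>
        obtain ⟨⟨u, v⟩, rfl⟩ := hl
        exact h.conj_eq w u v
      | one => simp
      | mul a b _ _ ha hb =>
        rw [← conj_mul, ha, hb, conj_mul]
      | inv a _ ha => rw [← conj_inv, ha, conj_inv]
    ext l
    simpa using this l l.2
  -- Although `x` is not multiplicative, conjugation by it is: `x (u * v)` is the commutator of `x
  -- u` and `y v` times `x v * x u`, and on `N` the element `y v` acts as `x v`.
  have hact : ∀ u v, (MulAut.conjNormal (x (u * v)) : MulAut N) =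
      MulAut.conjNormal (x u) * MulAut.conjNormal (x v) := by
    intro u v
    rw [h.mul_eq, h.gam_eq]
    simp only [map_mul, map_inv, hab]
    group
  refine ⟨
    { act := MonoidHom.mk' (fun u => MulAut.conjNormal (x u)) hact
      br := fun u v => ⟨gam y u v, hmem u v⟩
      br_mul_left := fun u v w => Subtype.ext (h.gam_mul_left u v w)
      br_mul_right := fun u v w => Subtype.ext ?_
      br_self := fun u => Subtype.ext (h.gam_self u)
      br_anti := fun u v => Subtype.ext (h.gam_anti u v)
      peiffer := fun u v l => ?_
      br_swap := fun u v a => Subtype.ext ?_ }, fun u v => rfl⟩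
  · simp only [MonoidHom.mk'_apply, hab, Subgroup.coe_mul, MulAut.conjNormal_apply]
    exact h.gam_mul_right u v w
  · rw [map_mul, map_mul, map_mul, map_inv, map_inv]
    simp only [MonoidHom.mk'_apply]
    rw [hab v, ← map_inv, ← map_inv, ← map_mul, ← map_mul, ← map_mul, ← h.gam_eq]
    exact Subtype.ext (MulAut.conjNormal_apply _ _).symm
  · simp only [MonoidHom.mk'_apply, hab, Subgroup.coe_mul, MulAut.conjNormal_apply,
      Subgroup.coe_inv]
    exact h.gam_swap u v a

end PairRel
end ParamSym

/-! ### Transposition calculus in `S_n(G)` and the map from Rehmann's group -/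

namespace ParamSym
open Equiv

variable {n : ℕ} {G : Type u} [Group G]

theorem conjPerm_left (s : Perm (Fin n)) (g : Fin n → G) (i : Fin n) :
    (conjPerm n G s g).left i = (g i)⁻¹ * g (s⁻¹ i) := by
  simp [conjPerm]
  rfl

theorem conjPerm_right (s : Perm (Fin n)) (g : Fin n → G) : (conjPerm n G s g).right = s := by
  simp [conjPerm]

theorem conjPerm_eq_iff (s : Perm (Fin n)) (g h : Fin n → G) :
    conjPerm n G s g = conjPerm n G s h ↔
      ∀ i, (g i)⁻¹ * g (s⁻¹ i) = (h i)⁻¹ * h (s⁻¹ i) := by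
  simp only [SemidirectProduct.ext_iff, funext_iff, conjPerm_left, conjPerm_right, and_true]

theorem sym_eq_of_conjPerm_eq {s : Perm (Fin n)} {g h : Fin n → G}
    (hgh : conjPerm n G s g = conjPerm n G s h) : sym n G s g = sym n G s h := by
  unfold sym
  rw [← mul_inv_eq_one, ← QuotientGroup.mk_inv, ← QuotientGroup.mk_mul, QuotientGroup.eq_one_iff]
  exact Subgroup.subset_normalClosure ⟨s, _, _, hgh, rfl⟩

theorem sym_mul (s t : Perm (Fin n)) (g : Fin n → G) :
    sym n G (s * t) g = sym n G s g * sym n G t g := by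
  simp [sym, freeSym]

theorem sym_one (g : Fin n → G) : sym n G 1 g = 1 := by
  simp [sym, freeSym]

/-- The conjugate of a transposition `(i j)` by `g` sees `g` only through `(g i)⁻¹ * g j`. -/
theorem sym_swap {i j : Fin n} (hij : i ≠ j) (g : Fin n → G) :
    sym n G (swap i j) g = transp n G i j ((g i)⁻¹ * g j) := by
  refine sym_eq_of_conjPerm_eq ((conjPerm_eq_iff _ _ _).2 fun k => ?_)
  rw [swap_inv]
  by_cases hki : k = i
  · subst hki
    simp [hij]
  · by_cases hkj : k = j
    · subst hkj
      simp [hij]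
    · rw [swap_apply_of_ne_of_ne hki hkj]
      simp

theorem transp_symm {i j : Fin n} (hij : i ≠ j) (a : G) :
    transp n G i j a = transp n G j i a⁻¹ := by
  rw [transp, swap_comm, sym_swap hij.symm]
  simp [hij]

theorem transp_mul_self (i j : Fin n) (a : G) : transp n G i j a * transp n G i j a = 1 := by
  rw [transp, ← sym_mul, swap_mul_self, sym_one]

theorem transp_inv (i j : Fin n) (a : G) : (transp n G i j a)⁻¹ = transp n G i j a :=
  inv_eq_of_mul_eq_one_left (transp_mul_self i j a)

/-- One vector `g` can be chosen for which all three transpositions lie in the same copy of `S_n`,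
where the identity is the usual one. -/
theorem transp_conj {i j k : Fin n} (hij : i ≠ j) (hik : i ≠ k) (hjk : j ≠ k) (a b : G) :
    transp n G i j a * transp n G j k b * transp n G i j a = transp n G i k (a * b) := by
  let g : Fin n → G := Pi.mulSingle j a * Pi.mulSingle k (a * b)
  have h1 : transp n G i j a = sym n G (swap i j) g := by
    rw [sym_swap hij]
    simp [g, hij, hik, hjk]
  have h2 : transp n G j k b = sym n G (swap j k) g := by
    rw [sym_swap hjk]
    simp [g, hjk]
  have h3 : transp n G i k (a * b) = sym n G (swap i k) g := by
    rw [sym_swap hik]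
    simp [g, hij, hik, hjk.symm]
  rw [h1, h2, h3, ← sym_mul, ← sym_mul]
  congr 1
  rw [swap_comm i j, swap_comm j k, swap_mul_swap_mul_swap hjk.symm hik.symm]

theorem transp_commute {i j k l : Fin n} (hij : i ≠ j) (hkl : k ≠ l) (hik : i ≠ k) (hil : i ≠ l)
    (hjk : j ≠ k) (hjl : j ≠ l) (a b : G) :
    transp n G i j a * transp n G k l b = transp n G k l b * transp n G i j a := by
  let g : Fin n → G := Pi.mulSingle j a * Pi.mulSingle l b
  have h1 : transp n G i j a = sym n G (swap i j) g := by
    rw [sym_swap hij]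
    simp [g, hij, hil, hjl]
  have h2 : transp n G k l b = sym n G (swap k l) g := by
    rw [sym_swap hkl]
    simp [g, hkl, hjk.symm, hjl.symm]
  rw [h1, h2, ← sym_mul, ← sym_mul]
  congr 1
  exact (Perm.disjoint_swap_swap (by simp [hij, hik, hil, hjk, hjl, hkl])).commute

theorem transp_conj_mid {i j k : Fin n} (hij : i ≠ j) (hik : i ≠ k) (hjk : j ≠ k) (a b : G) :
    transp n G j k b * transp n G i j a * transp n G j k b = transp n G i k (a * b) := by
  rw [transp_symm hjk, transp_symm hij, transp_conj hjk.symm hik.symm hij.symm, transp_symm hik]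
  simp

/-- Conjugation of `(i j)_a` by `(i j)`. -/
theorem transp_conj_self (hn : 3 ≤ n) {i j : Fin n} (hij : i ≠ j) (a : G) :
    transp n G i j 1 * transp n G i j a * transp n G i j 1 = transp n G i j a⁻¹ := by
  -- A third index lets `(i j)_a` be written as a conjugate of `(k j)_a` by `(i k)_1`; conjugation
  -- by `(i j)_1` is then known on each factor.
  obtain ⟨k, hki, hkj⟩ : ∃ k : Fin n, k ≠ i ∧ k ≠ j := by
    have : ({i, j} : Finset (Fin n)).card < Fintype.card (Fin n) := by
      rw [Finset.card_pair hij, Fintype.card_fin]; omega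
    obtain ⟨k, hk⟩ := Finset.exists_mem_notMem_of_card_lt_card
      (s := {i, j}) (t := Finset.univ) this
    simp only [Finset.mem_univ, Finset.mem_insert, Finset.mem_singleton, not_or, true_and] at hk
    exact ⟨k, hk⟩
  set t := transp n G i j 1 with ht
  have htt : t * t = 1 := transp_mul_self i j 1
  have e1 : t * transp n G i k 1 * t = transp n G j k 1 := by
    rw [ht, transp_symm hij, inv_one, transp_conj hij.symm hkj.symm hki.symm, one_mul]
  have e2 : t * transp n G k j a * t = transp n G k i a := by
    rw [ht, transp_symm hij, inv_one, transp_conj_mid hkj hki hij.symm, mul_one]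
  have e3 : transp n G i j a = transp n G i k 1 * transp n G k j a * transp n G i k 1 := by
    rw [transp_conj hki.symm hij hkj, one_mul]
  calc t * transp n G i j a * t
      = (t * transp n G i k 1 * t) * (t * transp n G k j a * t) * (t * transp n G i k 1 * t) := by
        rw [e3]
        simp only [mul_assoc]
        rw [← mul_assoc t t, htt, one_mul, ← mul_assoc t t, htt, one_mul]
    _ = _ := by rw [e1, e2, transp_conj hkj.symm hij.symm hki, one_mul, transp_symm hij.symm]

theorem mu_transp (i j : Fin n) (a : G) :
    mu n G (transp n G i j a) = conjPerm n G (swap i j) (Pi.mulSingle j a) := mu_sym ..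

theorem conjPerm_mul_conjPerm_one {i j : Fin n} (hij : i ≠ j) (a : G) :
    conjPerm n G (swap i j) (Pi.mulSingle j a) * conjPerm n G (swap i j) 1 =
      SemidirectProduct.inl (dVec n G i j a) := by
  refine SemidirectProduct.ext (funext fun k => ?_) ?_
  · rw [SemidirectProduct.mul_left, Pi.mul_apply, conjPerm_left]
    have : (conjPerm n G (swap i j) 1).left = 1 := by
      funext k
      simp [conjPerm_left]
    rw [this, map_one, Pi.one_apply, mul_one, swap_inv, SemidirectProduct.left_inl, dVec,
      Pi.mul_apply]
    by_cases hki : k = i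
    · subst hki
      simp [hij]
    · by_cases hkj : k = j
      · subst hkj
        simp [hij]
      · rw [swap_apply_of_ne_of_ne hki hkj]
        simp [hki, hkj]
  · simp [conjPerm_right]

theorem mu_hS {i j : Fin n} (hij : i ≠ j) (a : G) :
    mu n G (hS n G i j a) = SemidirectProduct.inl (dVec n G i j a) := by
  rw [hS, map_mul, mu_transp, mu_transp, Pi.mulSingle_one, conjPerm_mul_conjPerm_one hij]

theorem hS_mem {i j : Fin n} (hij : i ≠ j) (a : G) : hS n G i j a ∈ HS n G := by
  rw [HS, MonoidHom.mem_ker, projPerm, MonoidHom.comp_apply, mu_hS hij]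
  simp

theorem hS_inv (i j : Fin n) (a : G) :
    (hS n G i j a)⁻¹ = transp n G i j 1 * transp n G i j a := by
  rw [hS, mul_inv_rev, transp_inv, transp_inv]

theorem hS_mul_inv (i j : Fin n) (a b : G) :
    hS n G i j a * (hS n G i j b)⁻¹ = transp n G i j a * transp n G i j b := by
  rw [hS_inv, hS, mul_assoc, ← mul_assoc (transp n G i j 1), transp_mul_self, one_mul]

theorem hS_inv_eq (hn : 3 ≤ n) {i j : Fin n} (hij : i ≠ j) (a : G) :
    (hS n G i j a)⁻¹ = hS n G i j a⁻¹ := by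
  rw [hS_inv, hS, ← transp_conj_self hn hij, mul_assoc _ _ (transp n G i j 1), transp_mul_self,
    mul_one]

theorem hS_symm (hn : 3 ≤ n) {i j : Fin n} (hij : i ≠ j) (a : G) :
    hS n G j i a = (hS n G i j a)⁻¹ := by
  rw [hS_inv_eq hn hij, hS, hS, transp_symm hij.symm, transp_symm hij.symm, inv_one]

theorem hS_conj_left {i j k : Fin n} (hij : i ≠ j) (hik : i ≠ k) (hjk : j ≠ k) (u v : G) :
    hS n G i j u * transp n G i k v * (hS n G i j u)⁻¹ = transp n G i k (u * v) := by
  have e : transp n G i j 1 * transp n G i k v * transp n G i j 1 = transp n G j k v := by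
    rw [transp_symm hij, inv_one, transp_conj hij.symm hjk hik, one_mul]
  rw [hS_inv, hS, ← transp_conj hij hik hjk, ← e]
  simp only [mul_assoc]

theorem hS_conj_right {i j k : Fin n} (hij : i ≠ j) (hkj : k ≠ j) (hik : i ≠ k) (u v : G) :
    hS n G i j u * transp n G k j v * (hS n G i j u)⁻¹ = transp n G k j (v * u) := by
  have e : transp n G i j 1 * transp n G k j v * transp n G i j 1 = transp n G k i v := by
    rw [transp_symm hij, inv_one, transp_conj_mid hkj hik.symm hij.symm, mul_one]
  rw [hS_inv, hS, ← transp_conj_mid hik.symm hkj hij, ← e]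
  simp only [mul_assoc]

/-- `h_ij(u) h_ik(v) h_ij(u)⁻¹ = h_ik(uv) h_ik(u)⁻¹`. -/
theorem hS_rel_fst {i j k : Fin n} (hij : i ≠ j) (hik : i ≠ k) (hjk : j ≠ k) (u v : G) :
    hS n G i j u * hS n G i k v * (hS n G i j u)⁻¹ =
      hS n G i k (u * v) * (hS n G i k u)⁻¹ := by
  have e1 := hS_conj_left hij hik hjk u v
  have e2 := hS_conj_left hij hik hjk u 1
  rw [mul_one] at e2
  rw [hS_mul_inv, ← e1, ← e2, show hS n G i k v = transp n G i k v * transp n G i k 1 from rfl]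
  group

/-- `h_ij(u) h_kj(v) h_ij(u)⁻¹ = h_kj(vu) h_kj(u)⁻¹`. -/
theorem hS_rel_snd {i j k : Fin n} (hij : i ≠ j) (hkj : k ≠ j) (hik : i ≠ k) (u v : G) :
    hS n G i j u * hS n G k j v * (hS n G i j u)⁻¹ =
      hS n G k j (v * u) * (hS n G k j u)⁻¹ := by
  have e1 := hS_conj_right hij hkj hik u v
  have e2 := hS_conj_right hij hkj hik u 1
  rw [one_mul] at e2
  rw [hS_mul_inv, ← e1, ← e2, show hS n G k j v = transp n G k j v * transp n G k j 1 from rfl]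
  group

theorem transp_conj_hS_snd {i j k : Fin n} (hij : i ≠ j) (hik : i ≠ k) (hjk : j ≠ k) (u : G) :
    transp n G i j 1 * hS n G j k u * (transp n G i j 1)⁻¹ = hS n G i k u := by
  have e1 := transp_conj hij hik hjk (1 : G) u
  have e2 := transp_conj hij hik hjk (1 : G) 1
  rw [one_mul] at e1 e2
  rw [transp_inv, hS, hS, ← e1, ← e2]
  simp only [mul_assoc]
  rw [← mul_assoc (transp n G i j 1) (transp n G i j 1), transp_mul_self, one_mul]

theorem transp_conj_hS_fst (hn : 3 ≤ n) {i j k : Fin n} (hij : i ≠ j) (hik : i ≠ k) (hjk : j ≠ k)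
    (u : G) : transp n G j k 1 * hS n G i j u * (transp n G j k 1)⁻¹ = hS n G i k u := by
  rw [hS_symm hn hij.symm, ← conj_inv, transp_symm hjk, inv_one,
    transp_conj_hS_snd hjk.symm hik.symm hij.symm, ← hS_symm hn hik.symm]

/-- `h_ij(u) = h_kj(u) h_ik(u)`. -/
theorem hS_eq_mul {i j k : Fin n} (hij : i ≠ j) (hik : i ≠ k) (hjk : j ≠ k) (u : G) :
    hS n G i j u = hS n G k j u * hS n G i k u := by
  have e1 := transp_conj_mid hik hij hjk.symm u 1
  rw [mul_one] at e1
  have e2 := transp_conj_mid hij hik hjk u u⁻¹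
  rw [← transp_symm hjk.symm, mul_inv_cancel] at e2
  have e3 : transp n G k j 1 * transp n G i k u = transp n G i j u * transp n G k j 1 := by
    rw [← e1, mul_assoc, transp_mul_self, mul_one]
  have e4 : transp n G k j u * transp n G i j u = transp n G i k 1 * transp n G k j u := by
    rw [← e2, mul_assoc, transp_mul_self, mul_one]
  rw [← transp_conj_hS_snd hik hij hjk.symm, transp_inv, hS, hS, mul_assoc (transp n G k j u),
    ← mul_assoc (transp n G k j 1), e3]
  simp only [← mul_assoc]
  rw [e4]

theorem hS_commute {i j k l : Fin n} (hij : i ≠ j) (hkl : k ≠ l) (hik : i ≠ k) (hil : i ≠ l)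
    (hjk : j ≠ k) (hjl : j ≠ l) (a b : G) :
    hS n G i j a * hS n G k l b = hS n G k l b * hS n G i j a := by
  have c := fun a b => transp_commute (G := G) hij hkl hik hil hjk hjl a b
  have : Commute (hS n G i j a) (hS n G k l b) :=
    Commute.mul_left (Commute.mul_right (c _ _) (c _ _)) (Commute.mul_right (c _ _) (c _ _))
  exact this.eq

open scoped commutatorElement in
/-- The homomorphism from Rehmann's group to `S_n(G)`. -/
def rehmannToSym (n : ℕ) (hn : 3 ≤ n) (G : Type u) [Group G] : RehmannH n G →* SymG n G :=
  PresentedGroup.toGroup (f := fun x : HGen n G => hS n G x.1.1.1 x.1.1.2 x.2) (by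
    intro r hr
    simp only [Set.mem_ofPred_eq] at hr
    induction hr with
    | rel1 i j hij u =>
      simp only [fh, map_mul, FreeGroup.lift_apply_of]
      rw [hS_symm hn hij, mul_inv_cancel]
    | rel2 i j k hij hki hjk u =>
      simp only [fh, map_mul, FreeGroup.lift_apply_of]
      rw [hS_eq_mul hij hki.symm hjk, hS_symm hn hki.symm, hS_symm hn hjk.symm]
      group
    | rel3 i j k hij hik hjk u v =>
      simp only [fh, map_mul, map_inv, FreeGroup.lift_apply_of]
      rw [hS_rel_fst hij hik hjk, mul_inv_cancel]
    | rel4 i j k hij hkj hik u v =>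
      simp only [fh, map_mul, map_inv, FreeGroup.lift_apply_of]
      rw [hS_rel_snd hij hkj hik, mul_inv_cancel]
    | rel5 i j k l hij hkl hik hil hjk hjl u v =>
      simp only [fh, map_commutatorElement, FreeGroup.lift_apply_of]
      exact commutatorElement_eq_one_iff_mul_comm.2 (hS_commute hij hkl hik hil hjk hjl u v))

theorem rehmannToSym_hGen (hn : 3 ≤ n) {i j : Fin n} (hij : i ≠ j) (u : G) :
    rehmannToSym n hn G (hGen i j hij u) = hS n G i j u := by
  simp [rehmannToSym, hGen]

theorem closure_hGen : Subgroup.closure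
    {x : RehmannH n G | ∃ (i j : Fin n) (hij : i ≠ j) (u : G), x = hGen i j hij u} = ⊤ := by
  rw [eq_top_iff, ← PresentedGroup.closure_range_of, Subgroup.closure_le]
  rintro _ ⟨⟨⟨⟨i, j⟩, hij⟩, u⟩, rfl⟩
  exact Subgroup.subset_closure ⟨i, j, hij, u, rfl⟩

/-- `H_n(G)` modulo the relations `h_ij(a)⁻¹ = h_ij(a⁻¹)`. -/
abbrev InvQuot (n : ℕ) (G : Type u) [Group G] : Type u := RehmannH n G ⧸ invRel n G

/-- The homomorphism `h_ij(a) ↦ h_ij(a)` to `HS_n(G)`. -/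
def toHS (n : ℕ) (hn : 3 ≤ n) (G : Type u) [Group G] : InvQuot n G →* HS n G :=
  QuotientGroup.lift _ ((rehmannToSym n hn G).codRestrict (HS n G) (by
    intro x
    have hx : x ∈ Subgroup.closure
      {x : RehmannH n G | ∃ (i j : Fin n) (hij : i ≠ j) (u : G), x = hGen i j hij u} := by
      rw [closure_hGen]; trivial
    induction hx using Subgroup.closure_induction with
    | mem x hx =>
      obtain ⟨i, j, hij, u, rfl⟩ := hx
      rw [rehmannToSym_hGen]
      exact hS_mem hij u
    | one => rw [map_one]; exact one_mem _
    | mul x y _ _ hx hy => rw [map_mul]; exact mul_mem hx hy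
    | inv x _ hx => rw [map_inv]; exact inv_mem hx)) (by
    intro x hx
    refine Subgroup.normalClosure_le_normal (N := MonoidHom.ker _) ?_ hx
    rintro _ ⟨i, j, hij, a, rfl⟩
    refine Subtype.ext ?_
    change rehmannToSym n hn G _ = 1
    rw [map_mul, map_inv, map_inv, rehmannToSym_hGen, rehmannToSym_hGen, hS_inv_eq hn hij,
      mul_inv_cancel])

theorem toHS_mk_hGen (hn : 3 ≤ n) {i j : Fin n} (hij : i ≠ j) (u : G) :
    (toHS n hn G (QuotientGroup.mk (hGen i j hij u)) : SymG n G) = hS n G i j u :=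
  rehmannToSym_hGen hn hij u

end ParamSym

/-! ### Generation: surjectivity onto `HS_n(G)` and onto `D_n(G)` -/

namespace ParamSym
open Equiv

variable {n : ℕ} {G : Type u} [Group G]

/-- The subgroup of `S_n(G)` generated by the elements `h_ij(a)`. -/
def hSClosure (n : ℕ) (G : Type u) [Group G] : Subgroup (SymG n G) :=
  Subgroup.closure {x | ∃ (i j : Fin n) (_ : i ≠ j) (a : G), x = hS n G i j a}

theorem hS_mem_hSClosure {i j : Fin n} (hij : i ≠ j) (a : G) : hS n G i j a ∈ hSClosure n G :=
  Subgroup.subset_closure ⟨i, j, hij, a, rfl⟩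

theorem transp_conj_hS_mem (hn : 3 ≤ n) {i j k l : Fin n} (hij : i ≠ j) (hkl : k ≠ l) (a : G) :
    transp n G i j 1 * hS n G k l a * (transp n G i j 1)⁻¹ ∈ hSClosure n G := by
  have hself : ∀ {i j : Fin n}, i ≠ j → ∀ a : G,
      transp n G i j 1 * hS n G i j a * (transp n G i j 1)⁻¹ ∈ hSClosure n G := by
    intro i j hij a
    rw [hS, ← mul_assoc, mul_inv_cancel_right, ← hS_inv]
    exact inv_mem (hS_mem_hSClosure hij a)
  have hflip : transp n G i j 1 = transp n G j i 1 := by rw [transp_symm hij, inv_one]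
  by_cases hki : k = i
  · subst hki
    by_cases hlj : l = j
    · subst hlj
      exact hself hij a
    · rw [hflip, transp_conj_hS_snd hij.symm (Ne.symm hlj) hkl]
      exact hS_mem_hSClosure (Ne.symm hlj) a
  · by_cases hkj : k = j
    · subst hkj
      by_cases hli : l = i
      · subst hli
        rw [hflip]
        exact hself hkl a
      · rw [transp_conj_hS_snd hij (Ne.symm hli) hkl]
        exact hS_mem_hSClosure (Ne.symm hli) a
    · by_cases hli : l = i
      · subst hli
        rw [transp_conj_hS_fst hn hkl hkj hij]
        exact hS_mem_hSClosure hkj a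
      · by_cases hlj : l = j
        · subst hlj
          rw [hflip, transp_conj_hS_fst hn hkl hki hij.symm]
          exact hS_mem_hSClosure hki a
        · have c := fun a => transp_commute (G := G) hij hkl (Ne.symm hki) (Ne.symm hli)
            (Ne.symm hkj) (Ne.symm hlj) 1 a
          have : Commute (transp n G i j 1) (hS n G k l a) := Commute.mul_right (c _) (c _)
          rw [this.eq, mul_inv_cancel_right]
          exact hS_mem_hSClosure hkl a

theorem sym_mem_of_transp_mem (K : Subgroup (SymG n G))
    (hK : ∀ i j : Fin n, i ≠ j → ∀ a : G, transp n G i j a ∈ K) (s : Perm (Fin n))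
    (g : Fin n → G) : sym n G s g ∈ K := by
  induction s using Perm.swap_induction_on with
  | one => rw [sym_one]; exact one_mem _
  | swap_mul s i j hij hs =>
    rw [sym_mul, sym_swap hij]
    exact mul_mem (hK _ _ hij _) hs

theorem eq_top_of_transp_mem (K : Subgroup (SymG n G))
    (hK : ∀ i j : Fin n, i ≠ j → ∀ a : G, transp n G i j a ∈ K) : K = ⊤ := by
  rw [eq_top_iff]
  rintro x -
  obtain ⟨x, rfl⟩ := QuotientGroup.mk_surjective x
  induction x using Monoid.CoprodI.induction_on with
  | one => exact one_mem _
  | of g s => exact sym_mem_of_transp_mem K hK s g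
  | mul x y hx hy => exact mul_mem hx hy

theorem hSClosure_normal (hn : 3 ≤ n) : (hSClosure n G).Normal := by
  rw [← Subgroup.normalizer_eq_top_iff]
  have conj_mem : ∀ {i j : Fin n}, i ≠ j → ∀ x ∈ hSClosure n G,
      transp n G i j 1 * x * (transp n G i j 1)⁻¹ ∈ hSClosure n G := by
    intro i j hij x hx
    induction hx using Subgroup.closure_induction with
    | mem x hx =>
      obtain ⟨k, l, hkl, a, rfl⟩ := hx
      exact transp_conj_hS_mem hn hij hkl a
    | one => simp
    | mul x y _ _ hx hy => rw [← conj_mul]; exact mul_mem hx hy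
    | inv x _ hx => rw [← conj_inv]; exact inv_mem hx
  refine eq_top_of_transp_mem _ fun i j hij a => ?_
  have h1 : transp n G i j a = hS n G i j a * transp n G i j 1 := by
    rw [hS, mul_assoc, transp_mul_self, mul_one]
  rw [h1]
  refine mul_mem (Subgroup.le_normalizer (hS_mem_hSClosure hij a)) ?_
  rw [Subgroup.mem_normalizer_iff]
  refine fun x => ⟨conj_mem hij x, fun hx => ?_⟩
  have := conj_mem hij _ hx
  rw [transp_inv] at this
  simpa only [mul_assoc, transp_mul_self, mul_one, ← mul_assoc (transp n G i j 1)
    (transp n G i j 1), one_mul] using this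

/-- Modulo the normal subgroup generated by the `h_ij(a)`, all copies of `S_n` become equal, so the
quotient map factors through the projection to `S_n` and kills its kernel. -/
theorem HS_le_hSClosure (hn : 3 ≤ n) : HS n G ≤ hSClosure n G := by
  have := hSClosure_normal (G := G) hn
  let ρ : Perm (Fin n) →* SymG n G ⧸ hSClosure n G :=
    (QuotientGroup.mk' _).comp
      { toFun := fun s => sym n G s 1, map_one' := sym_one 1, map_mul' := fun s t => sym_mul s t 1 }
  have h1 : QuotientGroup.mk' (hSClosure n G) = ρ.comp (projPerm n G) := by
    refine sym_hom_ext n G fun s g => ?_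
    have h2 : projPerm n G (sym n G s g) = s := by
      rw [projPerm, MonoidHom.comp_apply, mu_sym]
      exact conjPerm_right s g
    rw [MonoidHom.comp_apply, h2]
    clear h2
    change (QuotientGroup.mk (sym n G s g) : SymG n G ⧸ hSClosure n G) =
      QuotientGroup.mk (sym n G s 1)
    induction s using Perm.swap_induction_on with
    | one => rw [sym_one, sym_one]
    | swap_mul s i j hij hs =>
      rw [sym_mul, sym_mul, QuotientGroup.mk_mul, QuotientGroup.mk_mul, hs]
      congr 1
      rw [sym_swap hij, sym_swap hij, eq_comm, QuotientGroup.eq]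
      simp only [Pi.one_apply, inv_one, mul_one]
      rw [transp_inv, ← inv_mem_iff, mul_inv_rev, transp_inv, transp_inv]
      exact hS_mem_hSClosure hij _
  intro x hx
  rw [← QuotientGroup.eq_one_iff]
  have := DFunLike.congr_fun h1 x
  rw [MonoidHom.comp_apply, MonoidHom.mem_ker.1 hx, map_one] at this
  exact this

theorem toHS_surjective (hn : 3 ≤ n) : Function.Surjective (toHS n hn G) := by
  rintro ⟨x, hx⟩
  have h1 : hSClosure n G ≤ (toHS n hn G).range.map (HS n G).subtype := by
    rw [hSClosure, Subgroup.closure_le]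
    rintro _ ⟨i, j, hij, a, rfl⟩
    exact ⟨_, ⟨QuotientGroup.mk (hGen i j hij a), rfl⟩, toHS_mk_hGen hn hij a⟩
  obtain ⟨_, ⟨q, rfl⟩, hq⟩ := h1 (HS_le_hSClosure hn hx)
  exact ⟨q, Subtype.ext hq⟩

theorem dVec_commutator {i j k : Fin n} (hij : i ≠ j) (hik : i ≠ k) (hjk : j ≠ k) (u v : G) :
    dVec n G i j u * dVec n G i k v * (dVec n G i j u)⁻¹ * (dVec n G i k v)⁻¹ =
      Pi.mulSingle i (u * v * u⁻¹ * v⁻¹) := by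
  funext m
  simp only [dVec, Pi.mul_apply, Pi.inv_apply, Pi.mulSingle_apply]
  split_ifs <;> simp_all

/-- The vectors `d_ij(u)` generate `D_n(G)`. -/
theorem D_le_of_dVec_mem (hn : 3 ≤ n) (K : Subgroup (Fin n → G))
    (hK : ∀ i j : Fin n, i ≠ j → ∀ u : G, dVec n G i j u ∈ K) : D n G ≤ K := by
  let i₀ : Fin n := ⟨0, by omega⟩
  let i₁ : Fin n := ⟨1, by omega⟩
  let i₂ : Fin n := ⟨2, by omega⟩
  have h01 : i₀ ≠ i₁ := by simp [i₀, i₁]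
  have h02 : i₀ ≠ i₂ := by simp [i₀, i₂]
  have h12 : i₁ ≠ i₂ := by simp [i₁, i₂]
  -- The vectors `d_{i₀ i₁}(u)` and `d_{i₀ i₂}(v)` overlap only in position `i₀`, so their
  -- commutator is concentrated there.
  have hcomm : ∀ c ∈ commutator G, Pi.mulSingle i₀ c ∈ K := by
    intro c hc
    have : commutator G ≤ K.comap (MonoidHom.mulSingle (fun _ : Fin n => G) i₀) := by
      rw [commutator_def, Subgroup.commutator_le]
      rintro u - v -
      rw [Subgroup.mem_comap, MonoidHom.mulSingle_apply, commutatorElement_def,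
        ← dVec_commutator h01 h02 h12]
      exact mul_mem (mul_mem (mul_mem (hK _ _ h01 _) (hK _ _ h02 _)) (inv_mem (hK _ _ h01 _)))
        (inv_mem (hK _ _ h02 _))
    exact this hc
  intro g hg
  -- Match the components of `g` one by one, letting position `i₀` absorb the inverses; what remains
  -- sits at `i₀` and lies in `[G, G]`.
  have key : ∀ s : Finset (Fin n), i₀ ∉ s → ∃ x ∈ K, x ∈ D n G ∧ (∀ m ∈ s, x m = g m) ∧
      ∀ m ∉ s, m ≠ i₀ → x m = 1 := by
    intro s
    induction s using Finset.induction_on with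
    | empty => exact fun _ => ⟨1, one_mem _, one_mem _, by simp, by simp⟩
    | insert k s hk ih =>
      intro h0
      rw [Finset.mem_insert, not_or] at h0
      obtain ⟨x, hx, hxD, hx1, hx2⟩ := ih h0.2
      have hk0 : k ≠ i₀ := Ne.symm h0.1
      refine ⟨x * dVec n G k i₀ (g k), mul_mem hx (hK _ _ hk0 _), mul_mem hxD (dVec_mem n G _ _ _),
        fun m hm => ?_, fun m hm hm0 => ?_⟩
      · rw [Finset.mem_insert] at hm
        rcases hm with rfl | hm
        · simp [dVec, hx2 m hk hk0, hk0]
        · have h1 : m ≠ k := fun h => hk (h ▸ hm)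
          have h2 : m ≠ i₀ := fun h => h0.2 (h ▸ hm)
          simp [dVec, hx1 m hm, h1, h2]
      · rw [Finset.mem_insert, not_or] at hm
        simp [dVec, hx2 m hm.2 hm0, hm.1, hm0]
  obtain ⟨x, hx, hxD, hx1, -⟩ := key (Finset.univ.erase i₀) (by simp)
  have h1 : x⁻¹ * g = Pi.mulSingle i₀ ((x⁻¹ * g) i₀) := by
    funext m
    by_cases hm : m = i₀
    · subst hm
      simp
    · simp [hm, hx1 m (by simp [hm])]
  have h2 : (x⁻¹ * g) i₀ ∈ commutator G := by
    have h3 : x⁻¹ * g ∈ D n G := mul_mem (inv_mem hxD) hg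
    rw [mem_D_iff, h1, abProd_mulSingle] at h3
    rwa [← Abelianization.ker_of, MonoidHom.mem_ker]
  have h3 : x⁻¹ * g ∈ K := by rw [h1]; exact hcomm _ h2
  simpa using mul_mem hx h3

theorem HStoD_surjective (hn : 3 ≤ n) : Function.Surjective (HStoD n G) := by
  have h := D_le_of_dVec_mem hn ((HStoD n G).range.map (D n G).subtype) (by
    intro i j hij u
    refine ⟨_, ⟨⟨hS n G i j u, hS_mem hij u⟩, rfl⟩, ?_⟩
    change (mu n G (hS n G i j u)).left = _
    rw [mu_hS hij, SemidirectProduct.left_inl])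
  rintro ⟨d, hd⟩
  obtain ⟨_, ⟨x, rfl⟩, hx⟩ := h hd
  exact ⟨x, Subtype.ext hx⟩

theorem HStoD_comp_toHS (hn : 3 ≤ n) :
    (HStoD n G).comp ((toHS n hn G).comp (QuotientGroup.mk' _)) = HtoD n G := by
  refine PresentedGroup.ext ?_
  rintro ⟨⟨⟨i, j⟩, hij⟩, u⟩
  refine Subtype.ext ?_
  change (mu n G (toHS n hn G (QuotientGroup.mk (hGen i j hij u)) : SymG n G)).left = _
  rw [toHS_mk_hGen, mu_hS hij, SemidirectProduct.left_inl]
  simp [HtoD]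

theorem isExtensionOfTypeH_HStoD (hn : 3 ≤ n) : IsExtensionOfTypeH n G (HStoD n G) :=
  ⟨HStoD_surjective hn, (toHS n hn G).comp (QuotientGroup.mk' _),
    (toHS_surjective hn).comp (QuotientGroup.mk'_surjective _), HStoD_comp_toHS hn⟩

theorem ker_mu_eq : (mu n G).ker = (HStoD n G).ker.map (HS n G).subtype := by
  ext x
  constructor
  · intro hx
    rw [MonoidHom.mem_ker] at hx
    have hx' : x ∈ HS n G := by
      rw [HS, MonoidHom.mem_ker, projPerm, MonoidHom.comp_apply, hx, map_one]
    refine ⟨⟨x, hx'⟩, ?_, rfl⟩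
    refine Subtype.ext ?_
    change (mu n G x).left = 1
    rw [hx, SemidirectProduct.one_left]
  · rintro ⟨⟨y, hy⟩, hy2, rfl⟩
    have h1 : (mu n G y).left = 1 := congrArg Subtype.val hy2
    have h2 : (mu n G y).right = 1 := hy
    exact SemidirectProduct.ext h1 h2

end ParamSym

/-! ### The kernel over `D_n(G)` is generated by the defects -/

namespace ParamSym
open Equiv

variable {n : ℕ} {G : Type u} [Group G]

/-- The generator `h_ij(u)` of `H_n(G)` modulo the relations `h_ij(a)⁻¹ = h_ij(a⁻¹)`. -/
def hQ (i j : Fin n) (hij : i ≠ j) (u : G) : InvQuot n G := QuotientGroup.mk (hGen i j hij u)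

theorem mk_eq_one_of_HRel {r : FreeGroup (HGen n G)} (hr : HRel n G r) :
    (QuotientGroup.mk' (invRel n G)) (PresentedGroup.mk {r | HRel n G r} r) = 1 := by
  have h : PresentedGroup.mk {r | HRel n G r} r = 1 := PresentedGroup.one_of_mem hr
  rw [h, map_one]

theorem hQ_symm {i j : Fin n} (hij : i ≠ j) (u : G) :
    hQ j i hij.symm u = (hQ i j hij u)⁻¹ := by
  have := mk_eq_one_of_HRel (HRel.rel1 i j hij u)
  rw [map_mul, map_mul] at this
  exact eq_inv_of_mul_eq_one_right this

theorem hQ_eq_mul {i j k : Fin n} (hij : i ≠ j) (hik : i ≠ k) (hkj : k ≠ j) (u : G) :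
    hQ i j hij u = hQ k j hkj u * hQ i k hik u := by
  have := mk_eq_one_of_HRel (HRel.rel2 i j k hij hik.symm hkj.symm u)
  rw [map_mul, map_mul, map_mul, map_mul, mul_assoc] at this
  have h2 : hQ i j hij u * (hQ k i hik.symm u * hQ j k hkj.symm u) = 1 := this
  rw [hQ_symm hik, hQ_symm hkj] at h2
  rw [eq_inv_of_mul_eq_one_left h2]
  group

theorem hQ_conj {i j k : Fin n} (hij : i ≠ j) (hik : i ≠ k) (hjk : j ≠ k) (u v : G) :
    hQ i j hij u * hQ i k hik v * (hQ i j hij u)⁻¹ = hQ i k hik (u * v) * (hQ i k hik u)⁻¹ := by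
  have := mk_eq_one_of_HRel (HRel.rel3 i j k hij hik hjk u v)
  simp only [map_mul, map_inv] at this
  exact mul_inv_eq_one.1 this

theorem hQ_inv {i j : Fin n} (hij : i ≠ j) (u : G) : hQ i j hij u⁻¹ = (hQ i j hij u)⁻¹ := by
  have h : (hGen i j hij u)⁻¹ * (hGen i j hij u⁻¹)⁻¹ ∈ invRel n G :=
    Subgroup.subset_normalClosure ⟨i, j, hij, u, rfl⟩
  rw [← QuotientGroup.eq_one_iff] at h
  exact (mul_inv_eq_one.1 h).symm

theorem pairRel_hQ {i j k : Fin n} (hij : i ≠ j) (hik : i ≠ k) (hjk : j ≠ k) :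
    PairRel (hQ (G := G) i j hij) (hQ i k hik) :=
  ⟨hQ_conj hij hik hjk, hQ_conj hik hij hjk.symm, hQ_inv hij, hQ_inv hik⟩

theorem gam_hQ_eq {i j k : Fin n} (hij : i ≠ j) (hik : i ≠ k) (u v : G) :
    gam (hQ i j hij) u v = gam (hQ i k hik) u v := by
  by_cases hjk : j = k
  · subst hjk
    rfl
  · exact (pairRel_hQ hij hik hjk).gam_eq_gam u v

theorem closure_hQ (i : Fin n) : Subgroup.closure
    {x : InvQuot n G | ∃ (j : Fin n) (hij : i ≠ j) (u : G), x = hQ i j hij u} = ⊤ := by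
  set C := Subgroup.closure {x : InvQuot n G | ∃ (j : Fin n) (hij : i ≠ j) (u : G), x = hQ i j hij u}
    with hC
  have h0 : ∀ (j : Fin n) (hij : i ≠ j) (u : G), hQ i j hij u ∈ C :=
    fun j hij u => Subgroup.subset_closure ⟨j, hij, u, rfl⟩
  have h1 : ∀ (j k : Fin n) (hjk : j ≠ k) (u : G), hQ j k hjk u ∈ C := by
    intro j k hjk u
    by_cases hj : i = j
    · subst hj
      exact h0 k hjk u
    · by_cases hk : i = k
      · subst hk
        rw [hQ_symm hjk.symm]
        exact inv_mem (h0 _ _ _)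
      · rw [hQ_eq_mul hjk (Ne.symm hj) hk, hQ_symm hj]
        exact mul_mem (h0 _ _ _) (inv_mem (h0 _ _ _))
  rw [eq_top_iff]
  rintro x -
  obtain ⟨x, rfl⟩ := QuotientGroup.mk_surjective x
  have hx : x ∈ (⊤ : Subgroup (RehmannH n G)) := trivial
  rw [← closure_hGen] at hx
  induction hx using Subgroup.closure_induction with
  | mem x hx =>
    obtain ⟨j, k, hjk, u, rfl⟩ := hx
    exact h1 j k hjk u
  | one => exact one_mem _
  | mul x y _ _ hx hy => exact mul_mem hx hy
  | inv x _ hx => exact inv_mem hx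

/-- The subgroup generated by the defects `h_ij(uv) h_ij(u)⁻¹ h_ij(v)⁻¹`. -/
def gamClosure {i j : Fin n} (hij : i ≠ j) : Subgroup (InvQuot n G) :=
  Subgroup.closure (Set.range fun p : G × G => gam (hQ i j hij) p.1 p.2)

theorem gam_mem {i j k : Fin n} (hij : i ≠ j) (hik : i ≠ k) (u v : G) :
    gam (hQ i k hik) u v ∈ gamClosure (G := G) hij := by
  rw [gam_hQ_eq hik hij]
  exact Subgroup.subset_closure ⟨(u, v), rfl⟩

/-- It suffices to conjugate by the generators `h_im(w)` with `i` fixed. A defect does not depend on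
the second index, so it can be written with an index other than `m`, and `conj_gam` applies. -/
theorem gamClosure_normal {i j k : Fin n} (hij : i ≠ j) (hik : i ≠ k) (hjk : j ≠ k) :
    (gamClosure (G := G) hij).Normal := by
  have conj_mem : ∀ (m : Fin n) (him : i ≠ m) (w : G), ∀ x ∈ gamClosure (G := G) hij,
      hQ i m him w * x * (hQ i m him w)⁻¹ ∈ gamClosure hij := by
    intro m him w x hx
    induction hx using Subgroup.closure_induction with
    | mem x hx =>
      obtain ⟨⟨u, v⟩, rfl⟩ := hx
      by_cases hmj : m = j
      · subst hmj
        dsimp only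
        rw [gam_hQ_eq him hik, (pairRel_hQ him hik hjk).conj_gam]
        exact mul_mem (gam_mem _ _ _ _) (inv_mem (gam_mem _ _ _ _))
      · dsimp only
        rw [(pairRel_hQ him hij hmj).conj_gam]
        exact mul_mem (gam_mem _ _ _ _) (inv_mem (gam_mem _ _ _ _))
    | one => simp
    | mul x y _ _ hx hy => rw [← conj_mul]; exact mul_mem hx hy
    | inv x _ hx => rw [← conj_inv]; exact inv_mem hx
  rw [← Subgroup.normalizer_eq_top_iff, eq_top_iff, ← closure_hQ i, Subgroup.closure_le]
  rintro _ ⟨m, him, w, rfl⟩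
  rw [SetLike.mem_coe, Subgroup.mem_normalizer_iff]
  refine fun x => ⟨conj_mem m him w x, fun hx => ?_⟩
  have := conj_mem m him w⁻¹ _ hx
  rw [hQ_inv] at this
  simpa [mul_assoc] using this

/-- Once the defects are killed, the `h_mi` become homomorphisms with commuting images for distinct
`m`. They assemble into a homomorphism out of `G^n`, trivial on coordinate `i`, through which the
quotient map factors; so whatever dies in `D_n(G)` dies modulo the defects. -/
theorem mem_gamClosure_of_toHS (hn : 3 ≤ n) {i j k : Fin n} (hij : i ≠ j) (hik : i ≠ k)
    (hjk : j ≠ k) {q : InvQuot n G} (hq : HStoD n G (toHS n hn G q) = 1) :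
    q ∈ gamClosure (G := G) hij := by
  have hnormal := gamClosure_normal (G := G) hij hik hjk
  let π := QuotientGroup.mk' (gamClosure (G := G) hij)
  have hgam : ∀ (m : Fin n) (him : i ≠ m) (u v : G), π (gam (hQ i m him) u v) = 1 := by
    intro m him u v
    exact (QuotientGroup.eq_one_iff _).2 (gam_mem hij him u v)
  -- Vanishing of `gam` makes `h_im` anti-multiplicative, hence the inverse family `h_mi`
  -- multiplicative.
  have hmul : ∀ (m : Fin n) (him : i ≠ m) (u v : G),
      π (hQ m i him.symm (u * v)) = π (hQ m i him.symm u) * π (hQ m i him.symm v) := by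
    intro m him u v
    have := hgam m him u v
    rw [gam, map_mul, map_mul, map_inv, map_inv, mul_inv_eq_one, mul_inv_eq_iff_eq_mul] at this
    rw [hQ_symm him, hQ_symm him, hQ_symm him, map_inv, map_inv, map_inv, this, mul_inv_rev]
  have hcomm : ∀ (m m' : Fin n) (him : i ≠ m) (him' : i ≠ m'), m ≠ m' → ∀ (u v : G),
      Commute (π (hQ m i him.symm u)) (π (hQ m' i him'.symm v)) := by
    intro m m' him him' hmm u v
    have := hgam m' him' u v
    rw [(pairRel_hQ him him' hmm).gam_eq, map_mul, map_mul, map_mul, map_inv, map_inv,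
      mul_inv_eq_one, mul_inv_eq_iff_eq_mul] at this
    rw [hQ_symm him, hQ_symm him', map_inv, map_inv]
    exact Commute.inv_inv (show Commute _ _ from this)
  let ϕ : ∀ _ : Fin n, G →* InvQuot n G ⧸ gamClosure (G := G) hij := fun m =>
    if him : i ≠ m then MonoidHom.mk' (fun u => π (hQ m i him.symm u)) (hmul m him) else 1
  have hϕ : ∀ (m : Fin n) (him : i ≠ m) (u : G), ϕ m u = π (hQ m i him.symm u) := by
    intro m him u
    simp [ϕ, him]
  have hϕ0 : ϕ i = 1 := by simp [ϕ]
  have hϕc : Pairwise fun a b => ∀ x y, Commute (ϕ a x) (ϕ b y) := by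
    intro a b hab x y
    by_cases ha : i = a
    · subst ha
      rw [hϕ0]
      exact Commute.one_left _
    · by_cases hb : i = b
      · subst hb
        rw [hϕ0]
        exact Commute.one_right _
      · rw [hϕ a ha, hϕ b hb]
        exact hcomm a b ha hb hab x y
  let Φ := MonoidHom.noncommPiCoprod ϕ hϕc
  have hΦ : ∀ m u, Φ (Pi.mulSingle m u) = ϕ m u := fun m u =>
    MonoidHom.noncommPiCoprod_mulSingle _ _ _
  have key : (Φ.comp (D n G).subtype).comp (HtoD n G) = π.comp (QuotientGroup.mk' _) := by
    refine PresentedGroup.ext ?_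
    rintro ⟨⟨⟨a, b⟩, hab⟩, u⟩
    change Φ (HtoD n G (PresentedGroup.of (⟨(a, b), hab⟩, u)) : Fin n → G) = π (hQ a b hab u)
    have h1 : (HtoD n G (PresentedGroup.of (⟨(a, b), hab⟩, u)) : Fin n → G) = dVec n G a b u := by
      simp [HtoD]
    rw [h1, dVec, map_mul, hΦ, hΦ]
    by_cases ha : i = a
    · subst ha
      rw [hϕ0, MonoidHom.one_apply, one_mul, hϕ b hab, hQ_symm hab, hQ_inv, inv_inv]
    · by_cases hb : i = b
      · subst hb
        rw [hϕ0, MonoidHom.one_apply, mul_one, hϕ a ha]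
      · rw [hϕ a ha, hϕ b hb, hQ_eq_mul hab (Ne.symm ha) hb, map_mul,
          (hcomm a b ha hb hab _ _).eq, hQ_inv, hQ_symm hb, inv_inv]
  obtain ⟨x, rfl⟩ := QuotientGroup.mk_surjective q
  have h1 : HtoD n G x = 1 := by
    rw [← HStoD_comp_toHS hn]
    exact hq
  have h2 := DFunLike.congr_fun key x
  rw [MonoidHom.comp_apply, h1, map_one] at h2
  exact (QuotientGroup.eq_one_iff _).1 h2.symm

end ParamSym

/-! ### Lifting `μ` to the wreath product of the tautological extension -/

namespace ParamSym
open Equiv TautExt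

variable {n : ℕ} {G : Type u} [Group G]

/-- The vectors of central elements of product one, as a subgroup of the wreath product. -/
noncomputable def antiDiag (n : ℕ) (G : Type u) [Group G] : Subgroup (Wreath n (TautExt G)) where
  carrier := {w | w.right = 1 ∧ ∃ r : Fin n → Multiplicative (ChainQuot G),
    ∏ i, r i = 1 ∧ ∀ i, w.left i = inc G (r i)}
  one_mem' := ⟨rfl, 1, by simp, by simp⟩
  mul_mem' := by
    rintro a b ⟨ha, r, hr, har⟩ ⟨hb, s, hs, hbs⟩
    refine ⟨by simp [ha, hb], r * s, by simp [Finset.prod_mul_distrib, hr, hs], fun i => ?_⟩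
    simp [ha, har, hbs]
  inv_mem' := by
    rintro a ⟨ha, r, hr, har⟩
    refine ⟨by simp [ha], r⁻¹, by simp [hr], fun i => ?_⟩
    simp [ha, har]

instance : (antiDiag n G).Normal where
  conj_mem := by
    rintro w ⟨hw, r, hr, hwr⟩ v
    refine ⟨by simp [hw], fun i => r (v.right⁻¹ i), ?_, fun i => ?_⟩
    · rw [← hr]
      exact Equiv.prod_comp v.right⁻¹ r
    · have h1 : (v * w * v⁻¹).left i = v.left i * w.left (v.right⁻¹ i) * (v.left i)⁻¹ := by
        simp only [SemidirectProduct.mul_left, SemidirectProduct.inv_left,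
          SemidirectProduct.mul_right, hw, mul_one, Pi.mul_apply]
        rw [← MulAut.mul_apply, ← map_mul, mul_inv_cancel, map_one, MulAut.one_apply]
        rfl
      rw [h1, hwr, ← inc_comm, mul_inv_cancel_right]

/-- The wreath product of the tautological extension modulo `antiDiag`. -/
abbrev WreathQuot (n : ℕ) (G : Type u) [Group G] : Type u := Wreath n (TautExt G) ⧸ antiDiag n G

/-- Changing the lift by central elements `r i` multiplies the conjugate by the vector `(r i)⁻¹ * r
(s⁻¹ i)`, whose components have product one. -/
theorem mk_conjPerm_eq_of_proj_eq (s : Perm (Fin n)) {γ δ : Fin n → TautExt G}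
    (h : ∀ i, proj G (γ i) = proj G (δ i)) :
    (QuotientGroup.mk (conjPerm n (TautExt G) s γ) : WreathQuot n G) =
      QuotientGroup.mk (conjPerm n (TautExt G) s δ) := by
  have h1 : ∀ i, ∃ m, inc G m = (δ i)⁻¹ * γ i := fun i =>
    exists_inc_of_proj_eq_one (by rw [map_mul, map_inv, h, inv_mul_cancel])
  choose r hr using h1
  have h2 : ∀ i, γ i = δ i * inc G (r i) := fun i => by rw [hr, mul_inv_cancel_left]
  have h3 : conjPerm n (TautExt G) s γ =
      SemidirectProduct.inl (fun i => inc G ((r i)⁻¹ * r (s⁻¹ i))) *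
        conjPerm n (TautExt G) s δ := by
    refine SemidirectProduct.ext (funext fun i => ?_) (by simp [conjPerm_right])
    rw [SemidirectProduct.mul_left, Pi.mul_apply, SemidirectProduct.left_inl,
      SemidirectProduct.right_inl, map_one, MulAut.one_apply, conjPerm_left, conjPerm_left,
      h2, h2, map_mul, map_inv, mul_inv_rev, mul_assoc (inc G (r i))⁻¹, mul_assoc (inc G (r i))⁻¹,
      inc_comm (r (s⁻¹ i)), mul_assoc (δ i)⁻¹]
  have h4 : (SemidirectProduct.inl (fun i => inc G ((r i)⁻¹ * r (s⁻¹ i))) :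
      Wreath n (TautExt G)) ∈ antiDiag n G := by
    refine ⟨rfl, _, ?_, fun i => rfl⟩
    rw [Finset.prod_mul_distrib, Finset.prod_inv_distrib, Equiv.prod_comp s⁻¹ r, inv_mul_cancel]
  rw [h3, QuotientGroup.mk_mul, (QuotientGroup.eq_one_iff _).2 h4, one_mul]

theorem mk_conjPerm_sec_eq {s : Perm (Fin n)} {g h : Fin n → G}
    (hgh : conjPerm n G s g = conjPerm n G s h) :
    (QuotientGroup.mk (conjPerm n (TautExt G) s fun i => sec (g i)) : WreathQuot n G) =
      QuotientGroup.mk (conjPerm n (TautExt G) s fun i => sec (h i)) := by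
  rw [conjPerm_eq_iff] at hgh
  -- Equality of the conjugates says that `g i * (h i)⁻¹` is constant along the cycles of `s`. Left
  -- multiplication by an `s`-invariant vector does not affect conjugates of `s`, and the new vector
  -- lifts `g`.
  have h1 : conjPerm n (TautExt G) s (fun i => sec (h i)) =
      conjPerm n (TautExt G) s (fun i => sec (g i * (h i)⁻¹) * sec (h i)) := by
    rw [conjPerm_eq_iff]
    intro i
    have h2 : g (s⁻¹ i) * (h (s⁻¹ i))⁻¹ = g i * (h i)⁻¹ := by
      rw [mul_inv_eq_iff_eq_mul, mul_assoc, ← hgh i, mul_inv_cancel_left]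
    rw [h2]
    group
  rw [h1]
  exact mk_conjPerm_eq_of_proj_eq s fun i => by simp [proj_sec]

/-- The lift of `μ` to the quotient of the wreath product of the tautological extension. -/
noncomputable def muLift (n : ℕ) (G : Type u) [Group G] : SymG n G →* WreathQuot n G :=
  symLift n G
    (fun g => (QuotientGroup.mk' (antiDiag n G)).comp (conjHom n (TautExt G) fun i => sec (g i)))
    (fun _ _ _ h => mk_conjPerm_sec_eq h)

theorem muLift_sym (s : Perm (Fin n)) (g : Fin n → G) :
    muLift n G (sym n G s g) = QuotientGroup.mk (conjPerm n (TautExt G) s fun i => sec (g i)) :=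
  symLift_sym ..

/-- The projection of the quotient to the wreath product. -/
noncomputable def projW (n : ℕ) (G : Type u) [Group G] : WreathQuot n G →* Wreath n G :=
  QuotientGroup.lift _ (wreathMap n (proj G)) (by
    rintro w ⟨hw, r, -, hr⟩
    refine SemidirectProduct.ext (funext fun i => ?_) hw
    change proj G (w.left i) = 1
    rw [hr, proj_inc])

theorem projW_muLift (x : SymG n G) : projW n G (muLift n G x) = mu n G x := by
  have : (projW n G).comp (muLift n G) = mu n G := by
    refine sym_hom_ext n G fun s g => ?_
    rw [MonoidHom.comp_apply, muLift_sym, mu_sym]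
    change wreathMap n (proj G) _ = _
    rw [wreathMap_conjPerm]
    rfl
  exact DFunLike.congr_fun this x

/-- The homomorphism from vectors to the quotient. -/
noncomputable def vecW (n : ℕ) (G : Type u) [Group G] : (Fin n → TautExt G) →* WreathQuot n G :=
  (QuotientGroup.mk' (antiDiag n G)).comp SemidirectProduct.inl

theorem vecW_eq_one_iff (v : Fin n → TautExt G) : vecW n G v = 1 ↔
    ∃ r : Fin n → Multiplicative (ChainQuot G), ∏ i, r i = 1 ∧ ∀ i, v i = inc G (r i) := by
  refine (QuotientGroup.eq_one_iff _).trans ?_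
  constructor
  · exact fun h => h.2
  · exact fun h => ⟨rfl, h⟩

theorem vecW_mulSingle_eq_one {i : Fin n} {x : TautExt G} (h : vecW n G (Pi.mulSingle i x) = 1) :
    x = 1 := by
  obtain ⟨r, hr, hx⟩ := (vecW_eq_one_iff _).1 h
  have h1 : ∀ j, j ≠ i → r j = 1 := by
    intro j hj
    have := hx j
    rw [Pi.mulSingle_eq_of_ne hj] at this
    exact inc_injective (by rw [← this, map_one])
  rw [Finset.prod_eq_single i (fun j _ hj => h1 j hj) (by simp)] at hr
  have := hx i
  rwa [Pi.mulSingle_eq_same, hr, map_one] at this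

theorem vecW_inc_eq (i : Fin n) (r : Fin n → Multiplicative (ChainQuot G)) :
    vecW n G (fun k => inc G (r k)) = vecW n G (Pi.mulSingle i (inc G (∏ k, r k))) := by
  rw [← mul_inv_eq_one, ← map_inv, ← map_mul, vecW_eq_one_iff]
  refine ⟨r * (Pi.mulSingle i (∏ k, r k))⁻¹, ?_, fun k => ?_⟩
  · simp only [Pi.mul_apply, Pi.inv_apply, Finset.prod_mul_distrib, Finset.prod_inv_distrib]
    rw [Finset.prod_pi_mulSingle']
    simp
  · by_cases hk : k = i
    · subst hk
      simp
    · simp [hk]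

theorem muLift_hS {i j : Fin n} (hij : i ≠ j) (u : G) :
    muLift n G (hS n G i j u) = vecW n G (dVec n (TautExt G) i j (sec u)) := by
  rw [hS, map_mul, transp, transp, muLift_sym, muLift_sym]
  have h1 := mk_conjPerm_eq_of_proj_eq (G := G) (swap i j)
    (γ := fun k => sec ((Pi.mulSingle j u : Fin n → G) k)) (δ := Pi.mulSingle j (sec u)) (by
      intro k
      by_cases hk : k = j
      · subst hk
        simp
      · simp [hk, proj_sec])
  have h2 := mk_conjPerm_eq_of_proj_eq (G := G) (swap i j)
    (γ := fun k => sec ((Pi.mulSingle j 1 : Fin n → G) k)) (δ := 1) (by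
      intro k
      simp [proj_sec])
  rw [h1, h2, ← QuotientGroup.mk_mul, conjPerm_mul_conjPerm_one hij]
  rfl

theorem muLift_toHS_gam (hn : 3 ≤ n) {i j k : Fin n} (hij : i ≠ j) (hik : i ≠ k) (hjk : j ≠ k)
    (u v : G) : muLift n G (toHS n hn G (gam (hQ i k hik) u v)) =
      vecW n G (Pi.mulSingle i (sec u * sec v * (sec u)⁻¹ * (sec v)⁻¹)) := by
  rw [(pairRel_hQ hij hik hjk).gam_eq, ← dVec_commutator hij hik hjk]
  have h : ∀ (a b : Fin n) (hab : a ≠ b) (w : G), muLift n G (toHS n hn G (hQ a b hab w)) =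
      vecW n G (dVec n (TautExt G) a b (sec w)) := by
    intro a b hab w
    rw [← muLift_hS hab, hQ, toHS_mk_hGen]
  simp only [map_mul, map_inv, Subgroup.coe_mul, Subgroup.coe_inv, h]

/-- A kernel element is a product of defects. The crossed pairing on the subgroup of defects yields
a homomorphism from `TautExt G` that recovers this product from the commutators seen by `muLift`. -/
theorem muLift_toHS_injective (hn : 3 ≤ n) :
    Function.Injective ((muLift n G).comp ((HS n G).subtype.comp (toHS n hn G))) := by
  rw [injective_iff_map_eq_one]
  intro q hq
  let i : Fin n := ⟨0, by omega⟩
  let j : Fin n := ⟨1, by omega⟩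
  let k : Fin n := ⟨2, by omega⟩
  have hij : i ≠ j := by simp [i, j]
  have hik : i ≠ k := by simp [i, k]
  have hjk : j ≠ k := by simp [j, k]
  have hq' : muLift n G (toHS n hn G q) = 1 := hq
  have hmem : q ∈ gamClosure (G := G) hik := by
    refine mem_gamClosure_of_toHS hn hik hij hjk.symm (Subtype.ext ?_)
    change (mu n G (toHS n hn G q)).left = 1
    rw [← projW_muLift, hq', map_one, SemidirectProduct.one_left]
  have hnormal := gamClosure_normal (G := G) hik hij hjk.symm
  obtain ⟨P, hP⟩ := (pairRel_hQ (G := G) hij hik hjk).exists_crossedPairing (gamClosure hik) rfl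
  obtain ⟨α, ξ, hξ, hα⟩ := exists_hom_of_crossedPairing P
  -- Spell `q` in defects and replace each `gam u v` by the commutator of `sec u` and `sec v`. The
  -- result `w` may depend on the spelling; it only has to relate `α w` to `q` and its vector at `i`
  -- to `muLift`.
  have key : ∃ w : TautExt G, α w = ξ ⟨q, hmem⟩ ∧
      muLift n G (toHS n hn G q) = vecW n G (Pi.mulSingle i w) := by
    clear hq hq'
    induction hmem using Subgroup.closure_induction with
    | mem q hq =>
      obtain ⟨⟨u, v⟩, rfl⟩ := hq
      refine ⟨_, (hα u v).trans (congrArg ξ (Subtype.ext (hP u v))), ?_⟩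
      exact muLift_toHS_gam hn hij hik hjk u v
    | one => exact ⟨1, by rw [map_one]; exact (map_one ξ).symm, by simp⟩
    | mul a b ha hb iha ihb =>
      obtain ⟨w, hw1, hw2⟩ := iha
      obtain ⟨w', hw1', hw2'⟩ := ihb
      refine ⟨w * w', ?_, ?_⟩
      · rw [map_mul, hw1, hw1', ← map_mul]
        rfl
      · rw [map_mul, Subgroup.coe_mul, map_mul, hw2, hw2', Pi.mulSingle_mul, map_mul]
    | inv a ha iha =>
      obtain ⟨w, hw1, hw2⟩ := iha
      refine ⟨w⁻¹, ?_, ?_⟩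
      · rw [map_inv, hw1, ← map_inv]
        rfl
      · rw [map_inv, Subgroup.coe_inv, map_inv, hw2, Pi.mulSingle_inv, map_inv]
  obtain ⟨w, hw1, hw2⟩ := key
  rw [hq'] at hw2
  have hw := vecW_mulSingle_eq_one hw2.symm
  rw [hw, map_one] at hw1
  have := hξ (hw1.symm.trans (map_one ξ).symm)
  exact congrArg Subtype.val this

theorem toHS_injective (hn : 3 ≤ n) : Function.Injective (toHS n hn G) := by
  have := muLift_toHS_injective (G := G) hn
  rw [MonoidHom.coe_comp, MonoidHom.coe_comp] at this
  exact this.of_comp.of_comp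

theorem muLift_injective_of_ker (hn : 3 ≤ n) {x : SymG n G} (hx : muLift n G x = 1) : x = 1 := by
  have hx' : x ∈ HS n G := by
    rw [HS, MonoidHom.mem_ker, projPerm, MonoidHom.comp_apply, ← projW_muLift, hx, map_one, map_one]
  obtain ⟨q, hq⟩ := toHS_surjective hn (⟨x, hx'⟩ : HS n G)
  have hq1 : q = 1 := by
    apply muLift_toHS_injective hn
    rw [map_one, MonoidHom.comp_apply, MonoidHom.comp_apply, hq]
    exact hx
  rw [hq1, map_one] at hq
  exact (congrArg Subtype.val hq).symm

/-! ### Identification of `Ker μ` with `H_2(G, ℤ)` -/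

/-- The second homology as a subgroup of the quotient. -/
noncomputable def homologyW (n : ℕ) (hn : 3 ≤ n) (G : Type u) [Group G] :
    H2Z G →* WreathQuot n G :=
  ((vecW n G).comp (MonoidHom.mulSingle (fun _ : Fin n => TautExt G) ⟨0, by omega⟩)).comp
    ((inc G).comp (AddMonoidHom.toMultiplicative (homologyInc G).toAddMonoidHom))

theorem homologyW_apply (hn : 3 ≤ n) (z : H2Z G) : homologyW n hn G z =
    vecW n G (Pi.mulSingle ⟨0, by omega⟩ (inc G (Multiplicative.ofAdd (homologyInc G z.toAdd)))) :=
  rfl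

theorem homologyW_injective (hn : 3 ≤ n) : Function.Injective (homologyW n hn G) := by
  rw [injective_iff_map_eq_one]
  intro z hz
  have h1 := vecW_mulSingle_eq_one hz
  have h2 := inc_injective (h1.trans (map_one (inc G)).symm)
  exact homologyInc_injective (h2.trans (map_zero (homologyInc G)).symm)

/-- The sum of the images of the components in 1-chains. -/
noncomputable def epsW (n : ℕ) (G : Type u) [Group G] :
    WreathQuot n G →* Multiplicative (G →₀ ZU.{u}) :=
  QuotientGroup.lift _
    (MonoidHom.mk' (fun w : Wreath n (TautExt G) => ∏ i, eps G (w.left i)) (by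
      intro a b
      simp only [SemidirectProduct.mul_left, Pi.mul_apply, map_mul, Finset.prod_mul_distrib]
      congr 1
      exact Equiv.prod_comp a.right⁻¹ fun i => eps G (b.left i))) (by
    rintro w ⟨-, r, hr, hw⟩
    change ∏ i, eps G (w.left i) = 1
    simp only [hw, eps_inc]
    rw [← ofAdd_sum, ← map_sum]
    have : ∑ i, (r i).toAdd = 0 := by
      rw [← toAdd_prod, hr, toAdd_one]
    rw [this, map_zero, ofAdd_zero])

/-- The components of `s ^ (sec g)` are `(sec (g i))⁻¹ * sec (g (s⁻¹ i))`, whose images in the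
commutative group of 1-chains cancel over `i`. -/
theorem epsW_muLift (x : SymG n G) : epsW n G (muLift n G x) = 1 := by
  have : (epsW n G).comp (muLift n G) = 1 := by
    refine sym_hom_ext n G fun s g => ?_
    rw [MonoidHom.comp_apply, muLift_sym]
    change ∏ i, eps G ((conjPerm n (TautExt G) s fun i => sec (g i)).left i) = 1
    simp only [conjPerm_left, map_mul, map_inv, Finset.prod_mul_distrib, Finset.prod_inv_distrib]
    rw [Equiv.prod_comp s⁻¹ fun i => eps G (sec (g i)), inv_mul_cancel]
  exact DFunLike.congr_fun this x

/-- The image of `x` is a central vector, which modulo `antiDiag` can be gathered in coordinate `0`;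
`epsW` then reads off the differential of its chain, which must vanish. -/
theorem muLift_mem_range (hn : 3 ≤ n) {x : SymG n G} (hx : mu n G x = 1) :
    muLift n G x ∈ (homologyW n hn G).range := by
  obtain ⟨w, hw⟩ := QuotientGroup.mk_surjective (muLift n G x)
  have h1 : wreathMap n (proj G) w = 1 := by
    rw [← hx, ← projW_muLift, ← hw]
    rfl
  have h2 : w.right = 1 := congrArg SemidirectProduct.right h1
  have h3 : ∀ i, ∃ m, inc G m = w.left i := fun i =>
    exists_inc_of_proj_eq_one (congrFun (congrArg SemidirectProduct.left h1) i)
  choose r hr using h3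
  have h4 : muLift n G x = vecW n G (Pi.mulSingle ⟨0, by omega⟩ (inc G (∏ k, r k))) := by
    rw [← vecW_inc_eq, ← hw]
    refine congrArg QuotientGroup.mk (SemidirectProduct.ext (funext fun i => (hr i).symm) h2)
  have h5 : chainD G (∏ k, r k).toAdd = 0 := by
    have h6 := epsW_muLift x
    rw [h4] at h6
    change ∏ i, eps G ((Pi.mulSingle _ (inc G (∏ k, r k)) : Fin n → TautExt G) i) = 1 at h6
    rw [Finset.prod_eq_single (⟨0, by omega⟩ : Fin n) (fun j _ hj => by simp [hj]) (by simp),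
      Pi.mulSingle_eq_same, eps_inc] at h6
    exact h6
  obtain ⟨z, hz⟩ := exists_homologyInc h5
  refine ⟨Multiplicative.ofAdd z, ?_⟩
  rw [homologyW_apply, h4, toAdd_ofAdd, hz, ofAdd_toAdd]

theorem homologyW_mem_range (hn : 3 ≤ n) (z : H2Z G) :
    ∃ x : SymG n G, mu n G x = 1 ∧ muLift n G x = homologyW n hn G z := by
  have h1 : inc G (Multiplicative.ofAdd (homologyInc G z.toAdd)) ∈ commutator (TautExt G) := by
    apply mem_commutator_of_eps_eq_one
    rw [eps_inc, toAdd_ofAdd, chainD_homologyInc, ofAdd_zero]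
  -- On generators, `d_ij(γ)` differs from the image of `h_ij(γ.val)` by `d_ij` of a central
  -- element, which lies in `antiDiag`.
  have h2 : D n (TautExt G) ≤ (muLift n G).range.comap (vecW n G) := by
    refine D_le_of_dVec_mem hn _ fun i j hij γ => ?_
    refine ⟨hS n G i j γ.val, ?_⟩
    rw [muLift_hS hij]
    have h3 : dVec n (TautExt G) i j γ = dVec n (TautExt G) i j (sec γ.val) *
        dVec n (TautExt G) i j (inc G (Multiplicative.ofAdd γ.cen)) := by
      funext m
      nth_rewrite 1 [eq_inc_mul_sec γ]
      simp only [dVec, Pi.mul_apply, Pi.mulSingle_apply]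
      by_cases hmi : m = i
      · subst hmi
        simp [hij, inc_comm]
      · by_cases hmj : m = j
        · subst hmj
          simp [hmi]
        · simp [hmi, hmj]
    rw [h3, map_mul, eq_comm, mul_eq_left, vecW_eq_one_iff]
    refine ⟨dVec n _ i j (Multiplicative.ofAdd γ.cen), ?_, fun m => ?_⟩
    · simp only [dVec, Pi.mul_apply, Finset.prod_mul_distrib]
      rw [Finset.prod_pi_mulSingle', Finset.prod_pi_mulSingle']
      simp
    · simp only [dVec, Pi.mul_apply, Pi.mulSingle_apply]
      split_ifs <;> simp
  obtain ⟨x, hx⟩ := h2 (show Pi.mulSingle ⟨0, by omega⟩ _ ∈ D n (TautExt G) by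
    rw [mem_D_iff, abProd_mulSingle, ← MonoidHom.mem_ker, Abelianization.ker_of]
    exact h1)
  refine ⟨x, ?_, hx⟩
  rw [← projW_muLift, hx]
  refine SemidirectProduct.ext (funext fun i => ?_) rfl
  change proj G ((Pi.mulSingle _ _ : Fin n → TautExt G) i) = 1
  simp only [Pi.mulSingle_apply]
  split_ifs
  · exact proj_inc _
  · exact map_one _

/-- The isomorphism of the kernel of `μ` with the second homology. -/
noncomputable def kerMuEquiv (n : ℕ) (hn : 3 ≤ n) (G : Type u) [Group G] :
    (mu n G).ker ≃* H2Z G :=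
  ((MonoidHom.ofInjective (f := (muLift n G).comp (mu n G).ker.subtype) (by
      rw [injective_iff_map_eq_one]
      exact fun x hx => Subtype.ext (muLift_injective_of_ker hn hx))).trans
    (MulEquiv.subgroupCongr (by
      refine le_antisymm ?_ ?_
      · rintro _ ⟨x, rfl⟩
        exact muLift_mem_range hn x.2
      · rintro _ ⟨z, rfl⟩
        obtain ⟨x, hx, hxz⟩ := homologyW_mem_range hn z
        exact ⟨⟨x, hx⟩, hxz⟩))).trans
    (MonoidHom.ofInjective (homologyW_injective (G := G) hn)).symm

theorem homologyW_kerMuEquiv (hn : 3 ≤ n) (x : (mu n G).ker) :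
    homologyW n hn G (kerMuEquiv n hn G x) = muLift n G x := by
  rw [kerMuEquiv, MulEquiv.trans_apply, MonoidHom.apply_ofInjective_symm]
  rfl

/-- The map of quotients induced by a homomorphism. -/
noncomputable def mapW (n : ℕ) {G G' : Type u} [Group G] [Group G'] (f : G →* G') :
    WreathQuot n G →* WreathQuot n G' :=
  QuotientGroup.map _ _ (wreathMap n (TautExt.map f)) (by
    rintro w ⟨hw, r, hr, hwr⟩
    refine ⟨hw, fun i => AddMonoidHom.toMultiplicative (chainQuotMap f).toAddMonoidHom (r i), ?_,
      fun i => ?_⟩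
    · rw [← map_prod, hr, map_one]
    · change TautExt.map f (w.left i) = _
      rw [hwr, map_inc]
      rfl)

theorem mapW_muLift {G' : Type u} [Group G'] (f : G →* G') (x : SymG n G) :
    mapW n f (muLift n G x) = muLift n G' (symMap n f x) := by
  have : (mapW n f).comp (muLift n G) = (muLift n G').comp (symMap n f) := by
    refine sym_hom_ext n G fun s g => ?_
    rw [MonoidHom.comp_apply, MonoidHom.comp_apply, muLift_sym, symMap_sym, muLift_sym]
    change QuotientGroup.mk (wreathMap n (TautExt.map f) _) = _
    rw [wreathMap_conjPerm]
    simp only [map_sec]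
  exact DFunLike.congr_fun this x

theorem mapW_homologyW (hn : 3 ≤ n) {G' : Type u} [Group G'] (f : G →* G') (z : H2Z G) :
    mapW n f (homologyW n hn G z) = homologyW n hn G' (H2Zmap f z) := by
  rw [homologyW_apply, homologyW_apply]
  have h1 : homologyInc G' (H2Zmap f z).toAdd = chainQuotMap f (homologyInc G z.toAdd) :=
    homologyInc_H2map f z.toAdd
  rw [h1]
  refine congrArg QuotientGroup.mk (SemidirectProduct.ext (funext fun i => ?_) rfl)
  change TautExt.map f ((Pi.mulSingle _ _ : Fin n → TautExt G) i) =
    (Pi.mulSingle _ _ : Fin n → TautExt G') i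
  simp only [Pi.mulSingle_apply]
  split_ifs
  · rw [map_inc, toAdd_ofAdd]
  · exact map_one _

theorem kerMuEquiv_natural (hn : 3 ≤ n) {G' : Type u} [Group G'] (f : G →* G')
    (x : (mu n G).ker) :
    kerMuEquiv n hn G' (kerMuMap n f x) = H2Zmap f (kerMuEquiv n hn G x) := by
  apply homologyW_injective hn
  rw [homologyW_kerMuEquiv, ← mapW_homologyW, homologyW_kerMuEquiv, mapW_muLift]
  rfl

end ParamSym

open ParamSym in
theorem mainTheorem3 (n : ℕ) (hn : 3 ≤ n) :
    (∀ (G : Type u) [Group G],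
      (∃ e : (RehmannH n G ⧸ invRel n G) ≃* HS n G,
        ∀ (i j : Fin n) (hij : i ≠ j) (a : G),
          ((e (QuotientGroup.mk (hGen i j hij a)) : HS n G) : SymG n G) = hS n G i j a) ∧
      IsExtensionOfTypeH n G (HStoD n G) ∧
      (mu n G).ker = (HStoD n G).ker.map (HS n G).subtype) ∧
    ∃ e : ∀ (G : Type u) [Group G], (mu n G).ker ≃* H2Z G,
      ∀ (G G' : Type u) [Group G] [Group G'] (f : G →* G') (x : (mu n G).ker),
        e G' (kerMuMap n f x) = H2Zmap f (e G x) := by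
  exact ⟨fun G _ => ⟨⟨MulEquiv.ofBijective (toHS n hn G) ⟨toHS_injective hn, toHS_surjective hn⟩,
      fun _ _ hij a => toHS_mk_hGen hn hij a⟩, isExtensionOfTypeH_HStoD hn, ker_mu_eq⟩,
    fun G _ => kerMuEquiv n hn G, fun _ _ _ _ f x => kerMuEquiv_natural hn f x⟩
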